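/- Let $A, B$ be self-adjoint operators on a complex Hilbert space $\mathcal H$ with $\mathcal D(|A|^{1/2})\subseteq\mathcal D(|B|^{1/2})$. Suppose that $A\ge 0$ and that $B$ is relatively $A$-form compact, that is, $|B|^{1/2}(A+I)^{-1}|B|^{1/2}$ (defined on $\mathcal D(|B|^{1/2})$) extends to a compact operator on $\mathcal H$. For a self-adjoint operator $T$ with positive and negative parts $T_\pm=\tfrac12(|T|\pm T)$ (in the sense of the functional calculus), the corresponding form is $\mathfrak t[x,y]=\langle T_+^{1/2}x,T_+^{1/2}y\rangle-\langle T_-^{1/2}x,T_-^{1/2}y\rangle$ with domain $\mathcal D(|T|^{1/2})$. Let $\mathfrak a,\mathfrak b$ be the forms corresponding to $A,B$. For a form $\mathfrak t$ with domain $\mathcal D(\mathfrak t)$ and an operator $T$ with domain $\mathcal D(T)$ let $$W_e(\mathfrak t)=\{z\in\mathbb C:\exists\,x_n\in\mathcal D(\mathfrak t),\ \|x_n\|=1,\ x_n\rightharpoonup 0,\ \mathfrak t[x_n,x_n]\to z\},$$ $$\sigma_e(T)=\{z\in\mathbb C:\exists\,x_n\in\mathcal D(T),\ \|x_n\|=1,\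 x_n\rightharpoonup 0,\ \|(T-z)x_n\|\to 0\}.$$ Then: 1. $W_e(\mathfrak a+i\mathfrak b)\subseteq[0,\infty)$. 2. The forms $\mathfrak a+z\mathfrak b$, $z\in\mathbb C$, are a holomorphic family of type (a): they are sectorial and closed, have a common dense domain, and depend holomorphically on $z$. For real $t$ the form $\mathfrak a+t\mathfrak b$ is symmetric, and there is a corresponding type (B) family, that is, for each $t\in\mathbb R$ a self-adjoint operator $A(t)$ whose domain is a core of $\mathfrak a+t\mathfrak b$ and which satisfies $\langle A(t)x,y\rangle=(\mathfrak a+t\mathfrak b)[x,y]$ for all $x,y\in\mathcal D(A(t))$. 3. If moreover $0\in\sigma_e(A)$, then for this type (B) family $\sigma_e(A(t))\subseteq\mathbb R$ and $\min\sigma_e(A(t))=0$ for all $t\in\mathbb R$. -/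

import Mathlib

open Filter Topology

noncomputable section

namespace EssNumRange

variable {H : Type*} [NormedAddCommGroup H] [InnerProductSpace ℂ H] [CompleteSpace H]

/-! ### Weak convergence, essential spectrum -/

/-- The sequence `x` converges weakly to `0`. -/
def WeaklyNull (x : ℕ → H) : Prop :=
  ∀ y : H, Tendsto (fun n => inner ℂ y (x n)) atTop (𝓝 0)

/-- The essential spectrum of an operator `T`: all `z` that admit a singular Weyl sequence. -/
def essSpectrum (T : H →ₗ.[ℂ] H) : Set ℂ :=
  {z | ∃ x : ℕ → T.domain, (∀ n, ‖(x n : H)‖ = 1) ∧ WeaklyNull (fun n => (x n : H)) ∧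
    Tendsto (fun n => ‖T (x n) - z • (x n : H)‖) atTop (𝓝 0)}

/-- `S ⊆ ℂ` consists of real numbers and has the smallest element `m`. -/
def IsRealMin (S : Set ℂ) (m : ℝ) : Prop :=
  (m : ℂ) ∈ S ∧ S ⊆ ((↑) : ℝ → ℂ) '' Set.Ici m

/-- `T ≥ 0`. -/
def OpNonneg (T : H →ₗ.[ℂ] H) : Prop :=
  ∀ x : T.domain, 0 ≤ (inner ℂ (x : H) (T x)).re

/-! ### Sesquilinear forms -/

/-- A sesquilinear form on a subspace of `H`, linear in the first and conjugate linear in the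
second argument. -/
structure SesqForm (H : Type*) [NormedAddCommGroup H] [InnerProductSpace ℂ H] where
  /-- The domain of the form. -/
  domain : Submodule ℂ H
  /-- The form on its domain. -/
  toFun : domain →ₗ[ℂ] domain →ₗ⋆[ℂ] ℂ

namespace SesqForm

/-- The quadratic form `𝔱[x] = 𝔱[x, x]`. -/
def quad (q : SesqForm H) (x : q.domain) : ℂ := q.toFun x x

/-- `p + c q` on the domain `D(p) ∩ D(q)`. -/
def addSmul (p : SesqForm H) (c : ℂ) (q : SesqForm H) : SesqForm H where
  domain := p.domain ⊓ q.domain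
  toFun := LinearMap.mk₂'ₛₗ (RingHom.id ℂ) (starRingEnd ℂ)
    (fun x y => p.toFun ⟨x, x.2.1⟩ ⟨y, y.2.1⟩ + c * q.toFun ⟨x, x.2.2⟩ ⟨y, y.2.2⟩)
    (fun x x' y => by
      have h1 := congrArg (fun f => f ⟨(y : H), y.2.1⟩)
        (p.toFun.map_add ⟨x, x.2.1⟩ ⟨x', x'.2.1⟩)
      have h2 := congrArg (fun f => f ⟨(y : H), y.2.2⟩)
        (q.toFun.map_add ⟨x, x.2.2⟩ ⟨x', x'.2.2⟩)
      simp only [LinearMap.add_apply] at h1 h2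
      erw [h1, h2]
      ring)
    (fun a x y => by
      have h1 := congrArg (fun f => f ⟨(y : H), y.2.1⟩) (p.toFun.map_smul a ⟨x, x.2.1⟩)
      have h2 := congrArg (fun f => f ⟨(y : H), y.2.2⟩) (q.toFun.map_smul a ⟨x, x.2.2⟩)
      simp only [LinearMap.smul_apply, smul_eq_mul] at h1 h2
      erw [h1, h2]
      simp only [RingHom.id_apply, smul_eq_mul]
      ring)
    (fun x y y' => by
      have h1 := (p.toFun ⟨x, x.2.1⟩).map_add ⟨y, y.2.1⟩ ⟨y', y'.2.1⟩
      have h2 := (q.toFun ⟨x, x.2.2⟩).map_add ⟨y, y.2.2⟩ ⟨y', y'.2.2⟩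
      erw [h1, h2]
      ring)
    (fun a x y => by
      have h1 := (p.toFun ⟨x, x.2.1⟩).map_smulₛₗ a ⟨y, y.2.1⟩
      have h2 := (q.toFun ⟨x, x.2.2⟩).map_smulₛₗ a ⟨y, y.2.2⟩
      erw [h1, h2]
      simp only [smul_eq_mul]
      ring)

/-- The essential numerical range of a form. -/
def essNumRange (q : SesqForm H) : Set ℂ :=
  {z | ∃ x : ℕ → q.domain, (∀ n, ‖(x n : H)‖ = 1) ∧ WeaklyNull (fun n => (x n : H)) ∧
    Tendsto (fun n => q.quad (x n)) atTop (𝓝 z)}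

/-- The form is symmetric. -/
def IsSymm (q : SesqForm H) : Prop :=
  ∀ x y : q.domain, q.toFun x y = starRingEnd ℂ (q.toFun y x)

/-- The form is sectorial: its numerical range lies in a sector with vertex `v`, symmetric about
the ray `v + [0, ∞)`, with semi-angle `θ < π / 2`; here `c = tan θ`. -/
def IsSectorial (q : SesqForm H) : Prop :=
  ∃ (v : ℂ) (c : ℝ), ∀ x : q.domain, ‖(x : H)‖ = 1 →
    0 ≤ (q.quad x - v).re ∧ |(q.quad x - v).im| ≤ c * (q.quad x - v).re

/-- The form is closed: if `x n → u` in `H` and `𝔱[x n - x m] → 0`, then `u` is in the domain and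
`𝔱[x n - u] → 0`. -/
def IsClosed (q : SesqForm H) : Prop :=
  ∀ (x : ℕ → q.domain) (u : H), Tendsto (fun n => (x n : H)) atTop (𝓝 u) →
    Tendsto (fun p : ℕ × ℕ => q.quad (x p.1 - x p.2)) atTop (𝓝 0) →
    ∃ h : u ∈ q.domain, Tendsto (fun n => q.quad (x n - ⟨u, h⟩)) atTop (𝓝 0)

/-- The subspace `V` is a core of the (closed) form. -/
def IsCore (q : SesqForm H) (V : Submodule ℂ H) : Prop :=
  V ≤ q.domain ∧ ∀ u : q.domain, ∃ x : ℕ → q.domain, (∀ n, (x n : H) ∈ V) ∧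
    Tendsto (fun n => (x n : H)) atTop (𝓝 (u : H)) ∧
    Tendsto (fun n => q.quad (x n - u)) atTop (𝓝 0)

end SesqForm

/-- `T` is the self-adjoint operator that corresponds to the form `q`: its domain is a core of `q`
and `⟨T x, y⟩ = q[x, y]` for all `x, y ∈ D(T)`. -/
def IsOperatorOf (T : H →ₗ.[ℂ] H) (q : SesqForm H) : Prop :=
  IsSelfAdjoint T ∧ q.IsCore T.domain ∧
    ∀ (x y : T.domain) (hx : (x : H) ∈ q.domain) (hy : (y : H) ∈ q.domain),
      inner ℂ (y : H) (T x) = q.toFun ⟨x, hx⟩ ⟨y, hy⟩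

/-- A holomorphic family of forms of type (a) with parameter `z ∈ ℂ`: all `q z` are sectorial and
closed, have one common dense domain, and `q z [x, y]` is holomorphic in `z`. -/
def IsTypeA (q : ℂ → SesqForm H) : Prop :=
  (∀ z, (q z).IsSectorial ∧ (q z).IsClosed) ∧
  ∃ (D : Submodule ℂ H) (hD : ∀ z, (q z).domain = D), Dense (D : Set H) ∧
    ∀ x y : D, Differentiable ℂ fun z =>
      (q z).toFun ⟨x, (hD z).symm ▸ x.2⟩ ⟨y, (hD z).symm ▸ y.2⟩

/-- `T t`, `t ∈ ℝ`, is the self-adjoint family of type (B) that corresponds to the type (a)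
family `q`. -/
def IsTypeBFamily (q : ℂ → SesqForm H) (T : ℝ → (H →ₗ.[ℂ] H)) : Prop :=
  IsTypeA q ∧ (∀ t : ℝ, (q t).IsSymm) ∧ ∀ t : ℝ, IsOperatorOf (T t) (q t)

/-! ### Functional calculus of an unbounded self-adjoint operator -/

open Classical in
/-- The bounded operator `(T + i)⁻¹` (and `0` if `T + i` has no bounded, everywhere defined
inverse; it always has one if `T` is self-adjoint). -/
def resolventI (T : H →ₗ.[ℂ] H) : H →L[ℂ] H :=
  if h : ∃ R : H →L[ℂ] H, ∀ x z : H, R z = x ↔ (x, z - Complex.I • x) ∈ T.graph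
  then h.choose else 0

/-- `(1 + T²)^{-1/2} = |(T + i)⁻¹|`, through the continuous functional calculus of the bounded
normal operator `(T + i)⁻¹`. -/
def weight (T : H →ₗ.[ℂ] H) : H →L[ℂ] H :=
  cfc (fun r : ℂ => ((‖r‖ : ℝ) : ℂ)) (resolventI T)

/-- The bounded operator `f(T) (1 + T²)^{-1/2}`, for a continuous `f : ℝ → ℝ` with
`f(s) / s → 0` as `|s| → ∞`: under `r = (s + i)⁻¹` we have `s = Re (r⁻¹)` and
`(1 + s²)^{-1/2} = |r|`. -/
def weighted (f : ℝ → ℝ) (T : H →ₗ.[ℂ] H) : H →L[ℂ] H :=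
  cfc (fun r : ℂ => ((f (r⁻¹).re * ‖r‖ : ℝ) : ℂ)) (resolventI T)

/-- The unbounded operator `f(T)`, for self-adjoint `T` and continuous `f : ℝ → ℝ` with
`f(s) / s → 0` as `|s| → ∞`. Its graph consists of the pairs `(x, y)` with
`f(T) (1 + T²)^{-1/2} x = (1 + T²)^{-1/2} y`. In a spectral representation, where `T` is the
multiplication by a real function `s`, this says that `f(s) x = y`; hence the domain is
`{x | f(s) x ∈ L²}`, as it should be. -/
def funCalc (f : ℝ → ℝ) (T : H →ₗ.[ℂ] H) : H →ₗ.[ℂ] H :=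
  (LinearMap.ker ((weighted f T).toLinearMap ∘ₗ LinearMap.fst ℂ H H
    - (weight T).toLinearMap ∘ₗ LinearMap.snd ℂ H H)).toLinearPMap

/-- `|T|^{1/2}`. -/
def sqrtAbs (T : H →ₗ.[ℂ] H) : H →ₗ.[ℂ] H := funCalc (fun s => √|s|) T

/-- `T₊^{1/2}`, the square root of the positive part. -/
def sqrtPos (T : H →ₗ.[ℂ] H) : H →ₗ.[ℂ] H := funCalc (fun s => √(max s 0)) T

/-- `T₋^{1/2}`, the square root of the negative part. -/
def sqrtNeg (T : H →ₗ.[ℂ] H) : H →ₗ.[ℂ] H := funCalc (fun s => √(max (-s) 0)) T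

theorem mem_funCalc_domain {f : ℝ → ℝ} {T : H →ₗ.[ℂ] H} {x : H} :
    x ∈ (funCalc f T).domain ↔ ∃ y, weighted f T x = weight T y := by
  simp [funCalc, Submodule.toLinearPMap_domain, sub_eq_zero]

theorem exists_eq_of_norm_inner_le (W : H →L[ℂ] H) (hW : IsSelfAdjoint W) (v : H) (C : ℝ)
    (h : ∀ u, ‖inner ℂ v u‖ ≤ C * ‖W u‖) : ∃ y, v = W y := by
  obtain ⟨s, hs⟩ := W.toLinearMap.rangeRestrict.exists_rightInverse_of_surjective
    (LinearMap.range_rangeRestrict _)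
  have hs' : ∀ w : LinearMap.range W.toLinearMap, W (s w) = w := fun w =>
    congrArg Subtype.val (LinearMap.congr_fun hs w)
  let φ : LinearMap.range W.toLinearMap →L[ℂ] ℂ :=
    LinearMap.mkContinuous ((innerₛₗ ℂ v) ∘ₗ s) C (fun w => by
      have := h (s w)
      rw [hs'] at this
      simpa using this)
  obtain ⟨g, hg, -⟩ := exists_extension_norm_eq _ φ
  refine ⟨(InnerProductSpace.toDual ℂ H).symm g, ?_⟩
  refine ext_inner_right ℂ fun u => ?_
  have hsym := (ContinuousLinearMap.isSelfAdjoint_iff_isSymmetric.mp hW)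
  have e1 : inner ℂ (W ((InnerProductSpace.toDual ℂ H).symm g)) u = g (W u) := by
    rw [← InnerProductSpace.toDual_symm_apply]
    exact hsym _ _
  rw [e1]
  have e2 := hg ⟨W u, LinearMap.mem_range_self _ u⟩
  rw [e2]
  have e3 := h (u - s ⟨W u, LinearMap.mem_range_self _ u⟩)
  rw [map_sub, hs'] at e3
  simp only [sub_self, norm_zero, mul_zero, norm_le_zero_iff, inner_sub_right, sub_eq_zero] at e3
  exact e3

theorem continuous_weighted_fun {f : ℝ → ℝ} (hf : Continuous f) (hb : ∀ s, |f s| ≤ √|s|) :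
    Continuous (fun r : ℂ => f (r⁻¹).re * ‖r‖) := by
  rw [continuous_iff_continuousAt]
  intro r
  by_cases hr : r = 0
  · subst hr
    have h0 : Tendsto (fun r : ℂ => √‖r‖) (𝓝 0) (𝓝 0) := by
      have : Continuous (fun r : ℂ => √‖r‖) := by fun_prop
      simpa using this.tendsto 0
    unfold ContinuousAt
    simp only [norm_zero, mul_zero]
    refine squeeze_zero_norm (fun r => ?_) h0
    have h1 : |f (r⁻¹).re| ≤ √(‖r‖⁻¹) := (hb _).trans
      (Real.sqrt_le_sqrt (by simpa using Complex.abs_re_le_norm (r⁻¹)))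
    rw [Real.norm_eq_abs, abs_mul, abs_norm]
    calc |f (r⁻¹).re| * ‖r‖ ≤ √(‖r‖⁻¹) * ‖r‖ := by gcongr
      _ = √‖r‖ := by
        by_cases h : ‖r‖ = 0
        · simp [h]
        · have hp : 0 < √‖r‖ := Real.sqrt_pos.2 (lt_of_le_of_ne (norm_nonneg _) (Ne.symm h))
          rw [Real.sqrt_inv]
          nth_rewrite 2 [← Real.mul_self_sqrt (norm_nonneg r)]
          field_simp
  · have h1 : ContinuousAt (fun r : ℂ => (r⁻¹).re) r :=
      Complex.continuous_re.continuousAt.comp (continuousAt_inv₀ hr)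
    exact (hf.continuousAt.comp h1).mul continuous_norm.continuousAt

theorem sqrtAbs_domain_le {f : ℝ → ℝ} (hf : Continuous f) (hb : ∀ s, |f s| ≤ √|s|)
    (T : H →ₗ.[ℂ] H) : (sqrtAbs T).domain ≤ (funCalc f T).domain := by
  intro x hx
  obtain ⟨y, hy⟩ := mem_funCalc_domain.1 hx
  rw [mem_funCalc_domain]
  by_cases hR : IsStarNormal (resolventI T)
  swap
  · exact ⟨0, by simp [weighted, cfc_apply_of_not_predicate _ hR]⟩
  have hG := continuous_weighted_fun (f := fun s => √|s|) (by fun_prop)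
    (fun s => by simp [abs_of_nonneg (Real.sqrt_nonneg _)])
  have hF := continuous_weighted_fun hf hb
  set G : ℂ → ℝ := fun r => √|(r⁻¹).re| * ‖r‖ with hGdef
  set F : ℂ → ℝ := fun r => f (r⁻¹).re * ‖r‖ with hFdef
  have hG0 : ∀ r, 0 ≤ G r := fun r => by positivity
  have hFG : ∀ r, |F r| ≤ G r := fun r => by
    simp only [hFdef, hGdef, abs_mul, abs_norm]
    gcongr
    exact hb _
  have hWsa : IsSelfAdjoint (weight T) := by
    rw [IsSelfAdjoint, weight, ← cfc_star]
    simp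
  refine exists_eq_of_norm_inner_le _ hWsa _ ‖y‖ fun u => ?_
  have key : ∀ ε : ℝ, 0 < ε →
      ‖inner ℂ (weighted f T x) u‖ ≤ ‖y‖ * ‖weight T u‖ + ε * (‖x‖ * ‖u‖) := by
    intro ε hε
    set k : ℂ → ℂ := fun r => ((F r / (G r + ε) : ℝ) : ℂ) with hk
    have hpos : ∀ r, 0 < G r + ε := fun r => by linarith [hG0 r]
    have hkc : Continuous k :=
      Complex.continuous_ofReal.comp (hF.div (hG.add continuous_const) fun r => (hpos r).ne')
    have hFc : Continuous (fun r : ℂ => ((F r : ℝ) : ℂ)) := Complex.continuous_ofReal.comp hF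
    have hGc : Continuous (fun r : ℂ => ((G r : ℝ) : ℂ)) := Complex.continuous_ofReal.comp hG
    set K := cfc k (resolventI T) with hK
    set E := cfc (fun r : ℂ => (F r : ℂ) - k r * (G r : ℂ)) (resolventI T) with hE
    have hKn : ‖K‖ ≤ 1 := by
      refine norm_cfc_le zero_le_one fun r _ => ?_
      rw [hk]
      simp only [Complex.norm_real, Real.norm_eq_abs, abs_div, abs_of_pos (hpos r)]
      rw [div_le_one (hpos r)]
      linarith [hFG r]
    have hEn : ‖E‖ ≤ ε := by
      refine norm_cfc_le hε.le fun r _ => ?_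
      have : (F r : ℂ) - k r * (G r : ℂ) = ((F r * (ε / (G r + ε)) : ℝ) : ℂ) := by
        have h1 : F r - F r / (G r + ε) * G r = F r * (ε / (G r + ε)) := by
          have := (hpos r).ne'
          field_simp
          ring
        rw [← h1, hk]
        push_cast
        ring
      rw [this, Complex.norm_real, Real.norm_eq_abs, abs_mul, abs_div, abs_of_pos hε,
        abs_of_pos (hpos r), ← mul_div_assoc, div_le_iff₀ (hpos r)]
      nlinarith [hFG r, abs_nonneg (F r), hG0 r]
    have hsplit : weighted f T = E + K * weighted (fun s => √|s|) T := by
      have h1 : cfc (fun r : ℂ => k r * (G r : ℂ)) (resolventI T)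
          = K * weighted (fun s => √|s|) T :=
        cfc_mul k (fun r : ℂ => (G r : ℂ)) _ hkc.continuousOn hGc.continuousOn
      have h2 : E = weighted f T - cfc (fun r : ℂ => k r * (G r : ℂ)) (resolventI T) :=
        cfc_sub (a := resolventI T) (fun r : ℂ => (F r : ℂ)) (fun r : ℂ => k r * (G r : ℂ))
          hFc.continuousOn (hkc.mul hGc).continuousOn
      rw [h2, h1]
      abel
    have hcomm : K (weight T y) = weight T (K y) :=
      congrArg (fun L : H →L[ℂ] H => L y) (cfc_commute_cfc k _ (resolventI T)).eq
    have hval : weighted f T x = E x + weight T (K y) := by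
      rw [hsplit]
      change E x + K (weighted (fun s => √|s|) T x) = _
      rw [hy, hcomm]
    have hsym : inner ℂ (weight T (K y)) u = inner ℂ (K y) (weight T u) :=
      (ContinuousLinearMap.isSelfAdjoint_iff_isSymmetric.mp hWsa) _ _
    rw [hval, inner_add_left, hsym]
    refine (norm_add_le _ _).trans ?_
    have b1 : ‖inner ℂ (E x) u‖ ≤ ε * (‖x‖ * ‖u‖) := by
      refine (norm_inner_le_norm _ _).trans ?_
      rw [← mul_assoc]
      gcongr
      exact E.le_of_opNorm_le hEn x
    have b2 : ‖inner ℂ (K y) (weight T u)‖ ≤ ‖y‖ * ‖weight T u‖ := by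
      refine (norm_inner_le_norm _ _).trans ?_
      gcongr
      simpa using K.le_of_opNorm_le hKn y
    linarith
  refine le_of_forall_pos_le_add fun δ hδ => ?_
  have hp : 0 < ‖x‖ * ‖u‖ + 1 := by positivity
  refine (key (δ / (‖x‖ * ‖u‖ + 1)) (by positivity)).trans ?_
  gcongr
  rw [div_mul_eq_mul_div, div_le_iff₀ hp]
  nlinarith

theorem sqrtAbs_domain_le_pos (T : H →ₗ.[ℂ] H) : (sqrtAbs T).domain ≤ (sqrtPos T).domain :=
  sqrtAbs_domain_le (by fun_prop) (fun s => by
    rw [abs_of_nonneg (Real.sqrt_nonneg _)]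
    exact Real.sqrt_le_sqrt (max_le (le_abs_self s) (abs_nonneg s))) T

theorem sqrtAbs_domain_le_neg (T : H →ₗ.[ℂ] H) : (sqrtAbs T).domain ≤ (sqrtNeg T).domain :=
  sqrtAbs_domain_le (by fun_prop) (fun s => by
    rw [abs_of_nonneg (Real.sqrt_nonneg _)]
    exact Real.sqrt_le_sqrt (max_le (neg_le_abs s) (abs_nonneg s))) T

/-! ### The form of a self-adjoint operator, relative form compactness -/

/-- The form that corresponds to the self-adjoint operator `T`, on the domain `D(|T|^{1/2})`:
`𝔱[x, y] = ⟨T₊^{1/2} x, T₊^{1/2} y⟩ - ⟨T₋^{1/2} x, T₋^{1/2} y⟩`. (Mathlib's inner product is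
conjugate linear in the first argument.) -/
def formOf (T : H →ₗ.[ℂ] H) : SesqForm H where
  domain := (sqrtAbs T).domain
  toFun :=
    let P : (sqrtAbs T).domain →ₗ[ℂ] H :=
      (sqrtPos T).toFun ∘ₗ Submodule.inclusion (sqrtAbs_domain_le_pos T)
    let N : (sqrtAbs T).domain →ₗ[ℂ] H :=
      (sqrtNeg T).toFun ∘ₗ Submodule.inclusion (sqrtAbs_domain_le_neg T)
    LinearMap.mk₂'ₛₗ (RingHom.id ℂ) (starRingEnd ℂ)
      (fun x y => inner ℂ (P y) (P x) - inner ℂ (N y) (N x))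
      (fun x x' y => by simp only [map_add, inner_add_right]; ring)
      (fun a x y => by
        simp only [map_smul, inner_smul_right, RingHom.id_apply, smul_eq_mul]; ring)
      (fun x y y' => by simp only [map_add, inner_add_left]; ring)
      (fun a x y => by simp only [map_smul, inner_smul_left, smul_eq_mul]; ring)

/-- The product `|B|^{1/2} (A + I)^{-1} |B|^{1/2}`, with its natural domain, is (the restriction
of) a compact operator `K` on `H`. Here `v = (A + I)^{-1} |B|^{1/2} x` is expressed by
`v ∈ D(A)` and `A v + v = |B|^{1/2} x`. -/
def IsRelFormCompact (A B : H →ₗ.[ℂ] H) : Prop :=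
  ∃ K : H →L[ℂ] H, IsCompactOperator K ∧
    ∀ (x : (sqrtAbs B).domain) (v : A.domain), A v + (v : H) = sqrtAbs B x →
      ∀ hv : (v : H) ∈ (sqrtAbs B).domain, sqrtAbs B ⟨v, hv⟩ = K x

end EssNumRange

end

open Filter Topology

noncomputable section

namespace EssNumRange

variable {H : Type*} [NormedAddCommGroup H] [InnerProductSpace ℂ H] [CompleteSpace H]

/-! ### The resolvent of a self-adjoint operator -/

/-! Everything is transported to `H` by the injective self-adjoint contraction `S = (A + 1)^{-1/2}`,
whose range is the domain of `𝔞`. Since `A (A + 1)⁻¹ = 1 - S²`, one has `𝔞[S u, S v] = ⟨u, v⟩ - ⟨S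
u, S v⟩`, and `𝔟[S u, S v] = ⟨G u, v⟩` for a bounded self-adjoint `G`. With `C = |B|^{1/2} S`, the
product `C C*` is the given compact operator. Hence `C`, and with it `G`, sends bounded weakly null
sequences to null sequences (`exists_transported_form`).

This compactness gives `|⟨G u, u⟩| ≤ ε ‖u‖² + M ‖S u‖²` for every `ε > 0` (`exists_form_bound`), so
`𝔟` is `𝔞`-form bounded with bound zero. Sectoriality follows, and the form norm of `S u` is
equivalent to `‖u‖`, so closedness is completeness of `H`. For a normalized weakly null sequence `S
u_n` with convergent form values, `u_n` is bounded and weakly null. The `G` term then disappears,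
and the limit is that of `‖u_n‖² - ‖S u_n‖² ≥ 0` (`exists_real_of_tendsto`).

For real `t` and large `c`, the operator `1 + (c - 1) S² + t G` is coercive with inverse `N`, and
`(A(t) + c)⁻¹ = S N S`. If `x_n` is a Weyl sequence of `A` at `0`, then `x_n - c (A(t) + c)⁻¹ x_n →
0`, so `0` is in the essential spectrum of `A(t)`. Conversely, a Weyl sequence of `A(t)` at `w` puts
`w` in the essential numerical range of `𝔞 + t𝔟`.

Functions of an unbounded `T` are handled through the normal operator `(T + i)⁻¹`: operator
identities become scalar identities in `s` on its spectrum, where `r = (s + i)⁻¹` or `r = 0`. -/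

theorem mem_graph_iff_of_isSelfAdjoint {T : H →ₗ.[ℂ] H} (hT : IsSelfAdjoint T) {x y : H} :
    (x, y) ∈ T.graph ↔ ∀ a b, (a, b) ∈ T.graph → inner ℂ b x = inner ℂ a y := by
  have h := LinearPMap.adjoint_graph_eq_graph_adjoint hT.dense_domain
  rw [LinearPMap.isSelfAdjoint_def.1 hT] at h
  conv_lhs => rw [h]
  simp [sub_eq_zero]

theorem inner_symm_of_isSelfAdjoint {T : H →ₗ.[ℂ] H} (hT : IsSelfAdjoint T) {a b x y : H}
    (hab : (a, b) ∈ T.graph) (hxy : (x, y) ∈ T.graph) : inner ℂ b x = inner ℂ a y :=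
  (mem_graph_iff_of_isSelfAdjoint hT).1 hxy a b hab

/-- Since `⟨T x, x⟩` is real and `c = ±i`, the cross term in `‖T x + c x‖²` vanishes, leaving `‖T
x‖² + ‖x‖²`. -/
theorem norm_le_of_mem_graph {T : H →ₗ.[ℂ] H} (hT : IsSelfAdjoint T) {c : ℂ}
    (hc : c = Complex.I ∨ c = -Complex.I) {x z : H} (h : (x, z - c • x) ∈ T.graph) :
    ‖x‖ ≤ ‖z‖ := by
  set y := z - c • x with hy
  have hz : z = y + c • x := by rw [hy]; abel
  have hs := inner_symm_of_isSelfAdjoint hT h h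
  have him : (inner ℂ y x).im = 0 := by
    have := congrArg Complex.im (inner_conj_symm (𝕜 := ℂ) y x)
    rw [← hs] at this
    simp only [Complex.conj_im] at this
    linarith
  have hre : (inner ℂ y (c • x)).re = 0 := by
    rw [inner_smul_right]
    rcases hc with rfl | rfl <;> simp [him]
  have hcn : ‖c‖ = 1 := by rcases hc with rfl | rfl <;> simp
  have e := norm_add_sq (𝕜 := ℂ) y (c • x)
  rw [← hz, norm_smul, hcn] at e
  simp only [RCLike.re_to_complex, hre] at e
  nlinarith [norm_nonneg z, norm_nonneg x, sq_nonneg ‖y‖]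

/-- The range of `T + c` is closed, by the lower bound and closedness of `T`. A vector `u`
orthogonal to it satisfies `T u = c u`, and the lower bound for `T - c` gives `u = 0`. -/
theorem exists_mem_graph_add_smul {T : H →ₗ.[ℂ] H} (hT : IsSelfAdjoint T) {c : ℂ}
    (hc : c = Complex.I ∨ c = -Complex.I) (z : H) : ∃ x, (x, z - c • x) ∈ T.graph := by
  let L : T.domain →ₗ[ℂ] H := T.toFun + c • T.domain.subtype
  have hL : ∀ v : T.domain, ((v : H), L v - c • (v : H)) ∈ T.graph := fun v => by
    have : L v - c • (v : H) = T v := by simp [L]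
    rw [this]
    exact T.mem_graph v
  have hbound : ∀ v : T.domain, ‖(v : H)‖ ≤ ‖L v‖ := fun v => norm_le_of_mem_graph hT hc (hL v)
  have hclosed : IsClosed (LinearMap.range L : Set H) := by
    refine IsSeqClosed.isClosed fun u w hu hw => ?_
    choose v hv using hu
    have hcau : CauchySeq (fun n => (v n : H)) := by
      have h1 := hw.cauchySeq
      rw [Metric.cauchySeq_iff] at h1 ⊢
      intro ε hε
      obtain ⟨N, hN⟩ := h1 ε hε
      refine ⟨N, fun m hm n hn => lt_of_le_of_lt ?_ (hN m hm n hn)⟩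
      have := hbound (v m - v n)
      rw [map_sub, hv, hv] at this
      simpa [dist_eq_norm] using this
    obtain ⟨x, hx⟩ := cauchySeq_tendsto_of_complete hcau
    have hlim : Tendsto (fun n => ((v n : H), L (v n) - c • (v n : H))) atTop
        (𝓝 (x, w - c • x)) := by
      simp only [hv]
      exact hx.prodMk_nhds (hw.sub (hx.const_smul c))
    have hmem := hT.isClosed.mem_of_tendsto hlim (Eventually.of_forall fun n => hL (v n))
    obtain ⟨y, hy1, hy2⟩ := T.mem_graph_iff.1 hmem
    refine ⟨y, ?_⟩
    simp only at hy1 hy2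
    change T y + c • (y : H) = w
    rw [hy2, hy1]
    abel
  have horth : (LinearMap.range L)ᗮ = ⊥ := by
    rw [Submodule.eq_bot_iff]
    intro u hu
    have h1 : (u, c • u) ∈ T.graph := by
      rw [mem_graph_iff_of_isSelfAdjoint hT]
      intro a b hab
      obtain ⟨y, hy1, hy2⟩ := T.mem_graph_iff.1 hab
      simp only at hy1 hy2
      have h2 := hu (L y) ⟨y, rfl⟩
      change inner ℂ (T y + c • (y : H)) u = 0 at h2
      rw [hy2, hy1, inner_add_left, inner_smul_left] at h2
      rw [inner_smul_right, eq_neg_of_add_eq_zero_left h2]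
      rcases hc with rfl | rfl <;> simp
    have h2 : ‖u‖ ≤ ‖(0 : H)‖ := by
      have hc' : -c = Complex.I ∨ -c = -Complex.I := by
        rcases hc with rfl | rfl <;> simp
      exact norm_le_of_mem_graph hT hc' (by simpa using h1)
    simpa using h2
  have htop : LinearMap.range L = ⊤ := by
    have : CompleteSpace (LinearMap.range L) := hclosed.completeSpace_coe
    exact (Submodule.orthogonal_eq_bot_iff).1 horth
  obtain ⟨v, hv⟩ : z ∈ LinearMap.range L := htop ▸ Submodule.mem_top
  exact ⟨v, hv ▸ hL v⟩

theorem exists_resolvent {T : H →ₗ.[ℂ] H} (hT : IsSelfAdjoint T) {c : ℂ}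
    (hc : c = Complex.I ∨ c = -Complex.I) :
    ∃ R : H →L[ℂ] H, ∀ x z : H, R z = x ↔ (x, z - c • x) ∈ T.graph := by
  choose r hr using exists_mem_graph_add_smul hT hc
  have huniq : ∀ x z, (x, z - c • x) ∈ T.graph → r z = x := fun x z h => by
    have h1 := T.graph.sub_mem (hr z) h
    have h2 : ‖r z - x‖ ≤ ‖(0 : H)‖ := norm_le_of_mem_graph hT hc (by
      have e : (0 : H) - c • (r z - x) = (z - c • r z) - (z - c • x) := by
        rw [smul_sub]; abel
      rw [e]
      exact h1)
    exact sub_eq_zero.1 (by simpa using h2)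
  let R : H →ₗ[ℂ] H :=
    { toFun := r
      map_add' := fun z w => huniq _ _ (by
        have e : z + w - c • (r z + r w) = (z - c • r z) + (w - c • r w) := by
          rw [smul_add]; abel
        rw [e]
        exact T.graph.add_mem (hr z) (hr w))
      map_smul' := fun a z => huniq _ _ (by
        have e : a • z - c • (a • r z) = a • (z - c • r z) := by
          rw [smul_sub, smul_comm]
        simp only [RingHom.id_apply]
        rw [e]
        exact T.graph.smul_mem a (hr z)) }
  refine ⟨R.mkContinuous 1 fun z => ?_, fun x z => ⟨?_, huniq x z⟩⟩
  · rw [one_mul]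
    exact norm_le_of_mem_graph hT hc (hr z)
  · rintro rfl
    exact hr z

theorem resolventI_apply_eq_iff {T : H →ₗ.[ℂ] H} (hT : IsSelfAdjoint T) {x z : H} :
    resolventI T z = x ↔ (x, z - Complex.I • x) ∈ T.graph := by
  have h := exists_resolvent hT (Or.inl rfl)
  rw [resolventI, dif_pos h]
  exact h.choose_spec x z

theorem resolventI_injective {T : H →ₗ.[ℂ] H} (hT : IsSelfAdjoint T) :
    Function.Injective (resolventI T) := by
  refine (injective_iff_map_eq_zero _).2 fun z hz => ?_
  have h := (resolventI_apply_eq_iff hT).1 hz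
  simp only [smul_zero, sub_zero] at h
  exact T.graph_fst_eq_zero_snd h rfl

/-- The resolvent identity for `∓i`; in weak form it is the symmetry of `T` tested on the range of
the resolvent. -/
theorem star_resolventI_sub {T : H →ₗ.[ℂ] H} (hT : IsSelfAdjoint T) :
    star (resolventI T) - resolventI T
      = (2 * Complex.I) • (star (resolventI T) * resolventI T) := by
  set R := resolventI T with hR
  ext w
  refine ext_inner_left ℂ fun z => ?_
  have hz := (resolventI_apply_eq_iff hT).1 (rfl : resolventI T z = R z)
  have hw := (resolventI_apply_eq_iff hT).1 (rfl : resolventI T w = R w)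
  have h := inner_symm_of_isSelfAdjoint hT hz hw
  simp only [inner_sub_left, inner_sub_right, inner_smul_left, inner_smul_right,
    Complex.conj_I] at h
  simp only [sub_apply, smul_apply,
    ContinuousLinearMap.star_eq_adjoint, mul_apply_eq_comp, inner_sub_right,
    inner_smul_right, ContinuousLinearMap.adjoint_inner_right]
  linear_combination -h

/-- The adjoint of `R = (T + i)⁻¹` is `(T - i)⁻¹`. The resolvent identity holds with the factors in
either order, and comparison gives `R* R = R R*`. -/
theorem isStarNormal_resolventI {T : H →ₗ.[ℂ] H} (hT : IsSelfAdjoint T) :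
    IsStarNormal (resolventI T) := by
  set R := resolventI T with hR
  obtain ⟨R', hR'⟩ := exists_resolvent hT (Or.inr rfl)
  have hadj : star R = R' := by
    ext w
    refine ext_inner_left ℂ fun z => ?_
    have hz := (resolventI_apply_eq_iff hT).1 (rfl : resolventI T z = R z)
    have hw := (hR' _ w).1 rfl
    have h := inner_symm_of_isSelfAdjoint hT hz hw
    simp only [inner_sub_left, inner_sub_right, inner_smul_left, inner_smul_right,
      Complex.conj_I] at h
    rw [ContinuousLinearMap.star_eq_adjoint, ContinuousLinearMap.adjoint_inner_right]
    linear_combination -h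
  have h2 : R' - R = (2 * Complex.I) • (R * R') := by
    have : R - R' = (-(2 * Complex.I)) • (R * R') := by
      ext w
      refine ext_inner_left ℂ fun z => ?_
      have hz := (hR' _ z).1 rfl
      have hw := (hR' _ w).1 rfl
      have h := inner_symm_of_isSelfAdjoint hT hz hw
      simp only [inner_sub_left, inner_sub_right, inner_smul_left, inner_smul_right, map_neg,
        Complex.conj_I] at h
      have hRR' : R = ContinuousLinearMap.adjoint R' := by
        rw [← hadj, ContinuousLinearMap.star_eq_adjoint, ContinuousLinearMap.adjoint_adjoint]
      simp only [sub_apply, smul_apply,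
        mul_apply_eq_comp, inner_sub_right, inner_smul_right]
      rw [hRR', ContinuousLinearMap.adjoint_inner_right, ContinuousLinearMap.adjoint_inner_right]
      linear_combination -h
    rw [← neg_sub, this, neg_smul, neg_neg]
  have h1 := star_resolventI_sub hT
  rw [← hR, hadj, h2] at h1
  refine ⟨?_⟩
  rw [hadj]
  have hne : (2 * Complex.I) ≠ 0 := by simp
  exact (smul_right_injective _ hne h1).symm

/-- The resolvent identity, read on the spectrum, is `r̄ - r = 2i |r|²`. For `r ≠ 0` this says that
`r⁻¹ = s + i` with `s` real. -/
theorem im_eq_of_mem_spectrum_resolventI {T : H →ₗ.[ℂ] H} (hT : IsSelfAdjoint T) {r : ℂ}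
    (hr : r ∈ spectrum ℂ (resolventI T)) : r.im = -‖r‖ ^ 2 := by
  have hN := isStarNormal_resolventI hT
  have h1 : cfc (fun r : ℂ => star r - r) (resolventI T)
      = cfc (fun r : ℂ => (2 * Complex.I) * (star r * r)) (resolventI T) := by
    rw [cfc_sub (fun r : ℂ => star r) (fun r => r), cfc_const_mul (2 * Complex.I)
      (fun r : ℂ => star r * r), cfc_mul (fun r : ℂ => star r) (fun r => r),
      cfc_star_id (resolventI T), cfc_id' ℂ (resolventI T)]
    exact star_resolventI_sub hT
  have h2 := eqOn_of_cfc_eq_cfc h1 (by fun_prop) (by fun_prop) hN hr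
  have h3 := congrArg Complex.im h2
  simp only [Complex.star_def, ← Complex.normSq_eq_conj_mul_self, Complex.sub_im,
    Complex.conj_im] at h3
  rw [Complex.normSq_eq_norm_sq] at h3
  simp [-Complex.ofReal_pow] at h3
  linarith

open ComplexOrder in
-- With `x = R z`, the real part of `⟨x, z⟩ = ⟨x, T x⟩ + i ‖x‖²` is nonnegative, so `R* + R ≥ 0`.
theorem re_nonneg_of_mem_spectrum_resolventI {T : H →ₗ.[ℂ] H} (hT : IsSelfAdjoint T)
    (hpos : OpNonneg T) {r : ℂ} (hr : r ∈ spectrum ℂ (resolventI T)) : 0 ≤ r.re := by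
  have hN := isStarNormal_resolventI hT
  have h1 : cfc (fun r : ℂ => star r + r) (resolventI T)
      = star (resolventI T) + resolventI T := by
    rw [cfc_add (resolventI T) (fun r : ℂ => star r) (fun r => r),
      cfc_star_id (resolventI T), cfc_id' ℂ (resolventI T)]
  have h2 : (0 : H →L[ℂ] H) ≤ star (resolventI T) + resolventI T := by
    rw [ContinuousLinearMap.nonneg_iff_isPositive, ContinuousLinearMap.isPositive_iff_complex]
    intro z
    set R := resolventI T with hR
    have hz := (resolventI_apply_eq_iff hT).1 (rfl : resolventI T z = R z)
    obtain ⟨y, hy1, hy2⟩ := T.mem_graph_iff.1 hz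
    simp only at hy1 hy2
    have h3 := hpos y
    rw [hy2, hy1] at h3
    have h4 : (inner ℂ (R z) z).re = (inner ℂ (R z) (z - Complex.I • R z)).re := by
      rw [inner_sub_right, inner_smul_right, inner_self_eq_norm_sq_to_K]
      simp [← Complex.ofReal_pow]
    have h5 : inner ℂ ((star R + R) z) z = ((2 * (inner ℂ (R z) z).re : ℝ) : ℂ) := by
      rw [add_apply, inner_add_left, ContinuousLinearMap.star_eq_adjoint,
        ContinuousLinearMap.adjoint_inner_left, ← inner_conj_symm z (R z),
        add_comm, Complex.add_conj]
    rw [h5]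
    refine ⟨by simp, ?_⟩
    rw [h4]
    simpa using h3
  rw [← h1, cfc_nonneg_iff _ _ (by fun_prop) hN] at h2
  have h3 := (Complex.le_def.1 (h2 r hr)).1
  simp at h3
  linarith

/-! ### Basic properties of the functional calculus -/

theorem isSelfAdjoint_cfc_ofReal (f : ℂ → ℝ) (R : H →L[ℂ] H) :
    IsSelfAdjoint (cfc (fun r : ℂ => (f r : ℂ)) R) := by
  rw [IsSelfAdjoint, ← cfc_star]
  simp

theorem cfc_mul_cfc_of_continuous {f g : ℂ → ℂ} (hf : Continuous f) (hg : Continuous g)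
    (R : H →L[ℂ] H) : cfc f R * cfc g R = cfc (fun r => f r * g r) R :=
  (cfc_mul f g R hf.continuousOn hg.continuousOn).symm

theorem cfc_add_cfc_of_continuous {f g : ℂ → ℂ} (hf : Continuous f) (hg : Continuous g)
    (R : H →L[ℂ] H) : cfc f R + cfc g R = cfc (fun r => f r + g r) R :=
  (cfc_add R f g hf.continuousOn hg.continuousOn).symm

theorem inner_map_comm_of_isSelfAdjoint {S : H →L[ℂ] H} (hS : IsSelfAdjoint S) (x y : H) :
    inner ℂ (S x) y = inner ℂ x (S y) :=
  ContinuousLinearMap.isSelfAdjoint_iff_isSymmetric.mp hS x y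

theorem isSelfAdjoint_weight (T : H →ₗ.[ℂ] H) : IsSelfAdjoint (weight T) :=
  isSelfAdjoint_cfc_ofReal (fun r => ‖r‖) _

theorem isSelfAdjoint_weighted (f : ℝ → ℝ) (T : H →ₗ.[ℂ] H) : IsSelfAdjoint (weighted f T) :=
  isSelfAdjoint_cfc_ofReal (fun r => f (r⁻¹).re * ‖r‖) _

/-- The square of the weight is `R* R`, and `R = (T + i)⁻¹` is injective. -/
theorem weight_injective {T : H →ₗ.[ℂ] H} (hT : IsSelfAdjoint T) :
    Function.Injective (weight T) := by
  have hN := isStarNormal_resolventI hT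
  refine (injective_iff_map_eq_zero _).2 fun y hy => resolventI_injective hT ?_
  have h1 : star (resolventI T) * resolventI T = weight T * weight T := by
    have h3 : star (resolventI T) * resolventI T
        = cfc (fun r : ℂ => star r * r) (resolventI T) := by
      rw [cfc_mul (fun r : ℂ => star r) (fun r => r), cfc_star_id (resolventI T),
        cfc_id' ℂ (resolventI T)]
    rw [h3, weight, cfc_mul_cfc_of_continuous (by fun_prop) (by fun_prop)]
    refine cfc_congr fun r _ => ?_
    simp only [Complex.star_def, ← Complex.normSq_eq_conj_mul_self, Complex.normSq_eq_norm_sq]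
    push_cast
    ring
  have h2 : inner ℂ (resolventI T y) (resolventI T y) = 0 := by
    rw [← ContinuousLinearMap.adjoint_inner_right, ← ContinuousLinearMap.star_eq_adjoint]
    change inner ℂ y ((star (resolventI T) * resolventI T) y) = 0
    rw [h1, mul_apply_eq_comp, hy, map_zero, inner_zero_right]
  rw [map_zero]
  exact inner_self_eq_zero.1 h2

theorem denseRange_of_isSelfAdjoint_of_injective {S : H →L[ℂ] H} (hS : IsSelfAdjoint S)
    (hinj : Function.Injective S) : DenseRange S := by
  have h : (LinearMap.range S.toLinearMap)ᗮ = ⊥ := by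
    rw [Submodule.eq_bot_iff]
    intro u hu
    refine hinj ?_
    rw [map_zero]
    refine ext_inner_left ℂ fun v => ?_
    rw [← inner_map_comm_of_isSelfAdjoint hS, inner_zero_right]
    exact hu _ ⟨v, rfl⟩
  have h2 := (Submodule.topologicalClosure_eq_top_iff).2 h
  exact (Submodule.dense_iff_topologicalClosure_eq_top).2 h2

/-- Injectivity of the weight makes the defining relation single-valued, so passing to a partial
linear map does not change the graph. -/
theorem mem_graph_funCalc {T : H →ₗ.[ℂ] H} (hT : IsSelfAdjoint T) (f : ℝ → ℝ) {x y : H} :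
    (x, y) ∈ (funCalc f T).graph ↔ weighted f T x = weight T y := by
  rw [funCalc, Submodule.toLinearPMap_graph_eq]
  · simp [sub_eq_zero]
  · rintro ⟨a, b⟩ h ha
    simp only at ha
    subst ha
    simp only [LinearMap.mem_ker, LinearMap.sub_apply, LinearMap.comp_apply, LinearMap.fst_apply,
      LinearMap.snd_apply, map_zero, zero_sub, neg_eq_zero] at h
    exact weight_injective hT (by simpa using h)

theorem weight_funCalc {T : H →ₗ.[ℂ] H} (hT : IsSelfAdjoint T) (f : ℝ → ℝ)
    (x : (funCalc f T).domain) : weight T (funCalc f T x) = weighted f T x :=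
  ((mem_graph_funCalc hT f).1 ((funCalc f T).mem_graph x)).symm

theorem funCalc_eq {T : H →ₗ.[ℂ] H} (hT : IsSelfAdjoint T) (f : ℝ → ℝ)
    (x : (funCalc f T).domain) {y : H} (h : weighted f T x = weight T y) : funCalc f T x = y :=
  weight_injective hT ((weight_funCalc hT f x).trans h)

theorem dense_funCalc_domain {T : H →ₗ.[ℂ] H} (hT : IsSelfAdjoint T) (f : ℝ → ℝ) :
    Dense ((funCalc f T).domain : Set H) := by
  refine (denseRange_of_isSelfAdjoint_of_injective (isSelfAdjoint_weight T)
    (weight_injective hT)).mono ?_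
  rintro _ ⟨u, rfl⟩
  exact mem_funCalc_domain.2 ⟨weighted f T u,
    congrArg (fun L : H →L[ℂ] H => L u) (cfc_commute_cfc _ _ (resolventI T)).eq⟩

/-- Bounded operators `J n = (W + (n + 1)⁻¹)⁻¹`, where `W = (1 + T²)^{-1/2}`. -/
theorem exists_regularization {T : H →ₗ.[ℂ] H} (hT : IsSelfAdjoint T) :
    ∃ J : ℕ → (H →L[ℂ] H),
      (∀ n f, Commute (J n) (weighted f T)) ∧ (∀ n, Commute (J n) (weight T)) ∧
      ∀ x, Tendsto (fun n => J n (weight T x)) atTop (𝓝 x) := by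
  have hN := isStarNormal_resolventI hT
  set R := resolventI T with hR
  set e : ℕ → ℝ := fun n => 1 / ((n : ℝ) + 1) with he
  have hepos : ∀ n, 0 < e n := fun n => by positivity
  set j : ℕ → ℂ → ℝ := fun n r => (‖r‖ + e n)⁻¹ with hj
  have hpos : ∀ n (r : ℂ), 0 < ‖r‖ + e n := fun n r => add_pos_of_nonneg_of_pos
    (norm_nonneg r) (hepos n)
  have hjc : ∀ n, Continuous (fun r : ℂ => ((j n r : ℝ) : ℂ)) := fun n =>
    Complex.continuous_ofReal.comp ((by fun_prop : Continuous fun r : ℂ => ‖r‖ + e n).inv₀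
      fun r => (hpos n r).ne')
  set J : ℕ → (H →L[ℂ] H) := fun n => cfc (fun r : ℂ => ((j n r : ℝ) : ℂ)) R with hJ
  refine ⟨J, fun n f => cfc_commute_cfc _ _ _,
    fun n => cfc_commute_cfc _ _ _, fun x => ?_⟩
  have hJW : ∀ n, J n * weight T = cfc (fun r : ℂ => ((j n r : ℝ) : ℂ) * ((‖r‖ : ℝ) : ℂ)) R :=
    fun n => (cfc_mul _ _ _ (hjc n).continuousOn (by fun_prop)).symm
  have hn1 : ∀ n, ‖J n * weight T‖ ≤ 1 := fun n => by
    rw [hJW]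
    refine norm_cfc_le zero_le_one fun r _ => ?_
    rw [← Complex.ofReal_mul, Complex.norm_real, Real.norm_eq_abs,
      abs_of_nonneg (mul_nonneg (inv_nonneg.2 (hpos n r).le) (norm_nonneg r)),
      inv_mul_le_iff₀ (hpos n r)]
    linarith [hepos n]
  have hn2 : ∀ n, ‖J n * weight T * weight T - weight T‖ ≤ e n := fun n => by
    have c1 : Continuous fun r : ℂ => ((‖r‖ : ℝ) : ℂ) := by fun_prop
    have h3 : J n * weight T * weight T - weight T = cfc (fun r : ℂ =>
        ((j n r : ℝ) : ℂ) * ((‖r‖ : ℝ) : ℂ) * ((‖r‖ : ℝ) : ℂ) - ((‖r‖ : ℝ) : ℂ)) R := by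
      have c2 : Continuous fun r : ℂ => ((j n r : ℝ) : ℂ) * ((‖r‖ : ℝ) : ℂ) := (hjc n).mul c1
      rw [hJW, weight, cfc_mul_cfc_of_continuous c2 c1]
      exact (cfc_sub (a := R) _ _ (c2.mul c1).continuousOn c1.continuousOn).symm
    rw [h3]
    refine norm_cfc_le (hepos n).le fun r _ => ?_
    rw [← Complex.ofReal_mul, ← Complex.ofReal_mul, ← Complex.ofReal_sub, Complex.norm_real,
      Real.norm_eq_abs]
    have h1 : j n r * ‖r‖ * ‖r‖ - ‖r‖ = -(e n * (‖r‖ / (‖r‖ + e n))) := by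
      have := (hpos n r).ne'
      simp only [hj]
      field_simp
      ring
    rw [h1, abs_neg, abs_of_nonneg (mul_nonneg (hepos n).le
      (div_nonneg (norm_nonneg r) (hpos n r).le))]
    refine mul_le_of_le_one_right (hepos n).le ((div_le_one (hpos n r)).2 ?_)
    linarith [hepos n]
  -- Strong convergence of `J n W` to the identity: on the dense range of `W` the error is at most
  -- `e n * ‖u‖`, and the bound `‖J n W‖ ≤ 1` extends the convergence to all vectors.
  rw [Metric.tendsto_atTop]
  intro δ hδ
  obtain ⟨u, hu⟩ := (denseRange_of_isSelfAdjoint_of_injective (isSelfAdjoint_weight T)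
    (weight_injective hT)).exists_dist_lt x (show 0 < δ / 3 by positivity)
  have h0 : Tendsto (fun n => e n * ‖u‖) atTop (𝓝 0) := by
    simpa [he] using (tendsto_one_div_add_atTop_nhds_zero_nat (𝕜 := ℝ)).mul_const ‖u‖
  obtain ⟨N, hN'⟩ :=
    (h0.eventually_lt_const (show (0 : ℝ) < δ / 3 by positivity)).exists_forall_of_atTop
  refine ⟨N, fun n hn => ?_⟩
  rw [dist_eq_norm] at hu ⊢
  have hsplit : J n (weight T x) - x = (J n * weight T) (x - weight T u)
      + (J n * weight T * weight T - weight T) u - (x - weight T u) := by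
    simp only [mul_apply_eq_comp, sub_apply, map_sub]
    abel
  have b1 := (J n * weight T).le_of_opNorm_le (hn1 n) (x - weight T u)
  have b2 := (J n * weight T * weight T - weight T).le_of_opNorm_le (hn2 n) u
  rw [hsplit]
  have b3 := norm_sub_le ((J n * weight T) (x - weight T u)
      + (J n * weight T * weight T - weight T) u) (x - weight T u)
  have b4 := norm_add_le ((J n * weight T) (x - weight T u))
      ((J n * weight T * weight T - weight T) u)
  linarith [hN' n hn]

/-- Since `J n W → 1` strongly, this expresses `f(T) x` as a limit of bounded operators applied to
`x`; identities between bounded operators then pass to `f(T)`. -/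
theorem regularization_funCalc {T : H →ₗ.[ℂ] H} (hT : IsSelfAdjoint T) {f : ℝ → ℝ}
    {J : H →L[ℂ] H} (hJ : Commute J (weighted f T)) (x : (funCalc f T).domain) :
    J (weight T (funCalc f T x)) = weighted f T (J x) := by
  rw [weight_funCalc hT]
  exact congrArg (fun L : H →L[ℂ] H => L x) hJ.eq

theorem inner_funCalc_comm {T : H →ₗ.[ℂ] H} (hT : IsSelfAdjoint T) (f : ℝ → ℝ)
    (x y : (funCalc f T).domain) : inner ℂ (funCalc f T x) (y : H)
      = inner ℂ (x : H) (funCalc f T y) := by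
  obtain ⟨J, hJf, hJW, hJt⟩ := exists_regularization hT
  have h1 : Tendsto (fun n => inner ℂ (funCalc f T x) (J n (weight T y))) atTop
      (𝓝 (inner ℂ (funCalc f T x) (y : H))) := tendsto_const_nhds.inner (hJt _)
  have h2 : Tendsto (fun n => inner ℂ (x : H) (J n (weight T (funCalc f T y)))) atTop
      (𝓝 (inner ℂ (x : H) (funCalc f T y))) := tendsto_const_nhds.inner (hJt _)
  refine tendsto_nhds_unique h1 (h2.congr fun n => ?_)
  have hc : J n (weight T y) = weight T (J n y) :=
    congrArg (fun L : H →L[ℂ] H => L y) (hJW n).eq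
  rw [regularization_funCalc hT (hJf n f), hc,
    ← inner_map_comm_of_isSelfAdjoint (isSelfAdjoint_weight T), weight_funCalc hT,
    inner_map_comm_of_isSelfAdjoint (isSelfAdjoint_weighted f T)]

theorem weighted_mul_weighted {f g : ℝ → ℝ} (hf : Continuous f) (hfb : ∀ s, |f s| ≤ √|s|)
    (hg : Continuous g) (hgb : ∀ s, |g s| ≤ √|s|) (T : H →ₗ.[ℂ] H) :
    weighted f T * weighted g T = cfc (fun r : ℂ =>
      ((f (r⁻¹).re * ‖r‖ : ℝ) : ℂ) * ((g (r⁻¹).re * ‖r‖ : ℝ) : ℂ)) (resolventI T) :=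
  (cfc_mul _ _ _ (Complex.continuous_ofReal.comp (continuous_weighted_fun hf hfb)).continuousOn
    (Complex.continuous_ofReal.comp (continuous_weighted_fun hg hgb)).continuousOn).symm

theorem abs_sqrt_abs_le (s : ℝ) : |(√|s|)| ≤ √|s| := by
  rw [abs_of_nonneg (Real.sqrt_nonneg _)]

theorem abs_sqrt_max_le (s : ℝ) : |√(max s 0)| ≤ √|s| := by
  rw [abs_of_nonneg (Real.sqrt_nonneg _)]
  exact Real.sqrt_le_sqrt (max_le (le_abs_self s) (abs_nonneg s))

theorem abs_sqrt_max_neg_le (s : ℝ) : |√(max (-s) 0)| ≤ √|s| := by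
  rw [abs_of_nonneg (Real.sqrt_nonneg _)]
  exact Real.sqrt_le_sqrt (max_le (neg_le_abs s) (abs_nonneg s))

/-- The scalar identity `s₊ + s₋ = |s|`, multiplied by `|r|²`. -/
theorem norm_weighted_sq_add (T : H →ₗ.[ℂ] H) (x : H) :
    ‖weighted (fun s => √(max s 0)) T x‖ ^ 2 + ‖weighted (fun s => √(max (-s) 0)) T x‖ ^ 2
      = ‖weighted (fun s => √|s|) T x‖ ^ 2 := by
  have hop : weighted (fun s => √(max s 0)) T * weighted (fun s => √(max s 0)) T
      + weighted (fun s => √(max (-s) 0)) T * weighted (fun s => √(max (-s) 0)) T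
      = weighted (fun s => √|s|) T * weighted (fun s => √|s|) T := by
    have c1 := Complex.continuous_ofReal.comp (continuous_weighted_fun
      (f := fun s => √(max s 0)) (by fun_prop) abs_sqrt_max_le)
    have c2 := Complex.continuous_ofReal.comp (continuous_weighted_fun
      (f := fun s => √(max (-s) 0)) (by fun_prop) abs_sqrt_max_neg_le)
    have c3 : Continuous fun s : ℝ => √(max s 0) := by fun_prop
    have c4 : Continuous fun s : ℝ => √(max (-s) 0) := by fun_prop
    have c5 : Continuous fun s : ℝ => √|s| := by fun_prop
    rw [weighted_mul_weighted c3 abs_sqrt_max_le c3 abs_sqrt_max_le,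
      weighted_mul_weighted c4 abs_sqrt_max_neg_le c4 abs_sqrt_max_neg_le,
      weighted_mul_weighted c5 abs_sqrt_abs_le c5 abs_sqrt_abs_le,
      cfc_add_cfc_of_continuous (by exact c1.mul c1) (by exact c2.mul c2)]
    refine cfc_congr fun r _ => ?_
    simp only [← Complex.ofReal_mul, ← Complex.ofReal_add]
    congr 1
    set s := (r⁻¹).re
    have e1 := Real.mul_self_sqrt (le_max_right s 0)
    have e2 := Real.mul_self_sqrt (le_max_right (-s) 0)
    have e3 := Real.mul_self_sqrt (abs_nonneg s)
    have e4 : max s 0 + max (-s) 0 = |s| := by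
      rcases le_total 0 s with h | h
      · simp [h, abs_of_nonneg h]
      · simp [h, abs_of_nonpos h]
    linear_combination ‖r‖ * ‖r‖ * (e1 + e2 - e3 + e4)
  have hsq : ∀ f, ((‖weighted f T x‖ ^ 2 : ℝ) : ℂ) = inner ℂ x ((weighted f T * weighted f T) x) :=
    fun f => by
      rw [mul_apply_eq_comp, ← inner_map_comm_of_isSelfAdjoint (isSelfAdjoint_weighted f T),
        inner_self_eq_norm_sq_to_K]
      simp
  have : ((‖weighted (fun s => √(max s 0)) T x‖ ^ 2
      + ‖weighted (fun s => √(max (-s) 0)) T x‖ ^ 2 : ℝ) : ℂ)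
      = ((‖weighted (fun s => √|s|) T x‖ ^ 2 : ℝ) : ℂ) := by
    rw [Complex.ofReal_add, hsq, hsq, hsq, ← hop, add_apply, inner_add_right]
  exact_mod_cast this

theorem norm_sqrtPos_sq_add_norm_sqrtNeg_sq {T : H →ₗ.[ℂ] H} (hT : IsSelfAdjoint T)
    (x : (sqrtAbs T).domain) :
    ‖sqrtPos T ⟨x, sqrtAbs_domain_le_pos T x.2⟩‖ ^ 2
      + ‖sqrtNeg T ⟨x, sqrtAbs_domain_le_neg T x.2⟩‖ ^ 2 = ‖sqrtAbs T x‖ ^ 2 := by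
  obtain ⟨J, hJf, -, hJt⟩ := exists_regularization hT
  have h1 := (((hJt (sqrtPos T ⟨x, sqrtAbs_domain_le_pos T x.2⟩)).norm.pow 2).add
    ((hJt (sqrtNeg T ⟨x, sqrtAbs_domain_le_neg T x.2⟩)).norm.pow 2))
  have h2 := (hJt (sqrtAbs T x)).norm.pow 2
  refine tendsto_nhds_unique h1 (h2.congr fun n => ?_)
  have r0 := regularization_funCalc hT (hJf n _) x
  have r1 := regularization_funCalc hT (hJf n _) ⟨x, sqrtAbs_domain_le_pos T x.2⟩
  have r2 := regularization_funCalc hT (hJf n _) ⟨x, sqrtAbs_domain_le_neg T x.2⟩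
  change J n (weight T (sqrtAbs T x)) = _ at r0
  change J n (weight T (sqrtPos T ⟨x, sqrtAbs_domain_le_pos T x.2⟩)) = _ at r1
  change J n (weight T (sqrtNeg T ⟨x, sqrtAbs_domain_le_neg T x.2⟩)) = _ at r2
  rw [r0, r1, r2, norm_weighted_sq_add]

/-! ### The operator `(A + 1)^{-1/2}` and the form of a nonnegative operator -/

/-- The function of `r = (s + i)⁻¹`, `s ≥ 0`, that is equal to `(1 + s)^{-1/2}`. -/
def invSqrtShiftFun (r : ℂ) : ℝ := √(‖r‖ / max 1 (‖r‖ + r.re / ‖r‖))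

/-- For `r = (s + i)⁻¹` with `s ≥ 0`, the second entry of the maximum is `(1 + s) / √(1 + s²) ≥ 1`,
so the maximum is inert there. Elsewhere it keeps the denominator at least `1`, which gives
continuity at `0`. -/
theorem continuous_invSqrtShiftFun : Continuous invSqrtShiftFun := by
  refine Real.continuous_sqrt.comp (continuous_iff_continuousAt.2 fun r => ?_)
  have hpos : ∀ r : ℂ, 0 < max 1 (‖r‖ + r.re / ‖r‖) := fun r =>
    lt_of_lt_of_le one_pos (le_max_left _ _)
  by_cases hr : r = 0
  · subst hr
    unfold ContinuousAt
    simp only [norm_zero, zero_div]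
    have h0 : Tendsto (fun r : ℂ => ‖r‖) (𝓝 0) (𝓝 0) := by
      simpa using continuous_norm.tendsto (0 : ℂ)
    refine squeeze_zero (fun r => div_nonneg (norm_nonneg r) (hpos r).le) (fun r => ?_) h0
    exact div_le_self (norm_nonneg r) (le_max_left _ _)
  · have hn : ‖r‖ ≠ 0 := norm_ne_zero_iff.2 hr
    refine continuous_norm.continuousAt.div ?_ (hpos r).ne'
    exact continuousAt_const.max (continuous_norm.continuousAt.add
      (Complex.continuous_re.continuousAt.div continuous_norm.continuousAt hn))

/-- `(A + 1)^{-1/2}`, for nonnegative self-adjoint `A`. -/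
def invSqrtShift (A : H →ₗ.[ℂ] H) : H →L[ℂ] H :=
  cfc (fun r : ℂ => (invSqrtShiftFun r : ℂ)) (resolventI A)

/-- `A^{1/2} (A + 1)^{-1/2}`, for nonnegative self-adjoint `A`. -/
def sqrtMulInvSqrtShift (A : H →ₗ.[ℂ] H) : H →L[ℂ] H :=
  cfc (fun r : ℂ => (√(1 - invSqrtShiftFun r ^ 2) : ℂ)) (resolventI A)

theorem isSelfAdjoint_invSqrtShift (A : H →ₗ.[ℂ] H) : IsSelfAdjoint (invSqrtShift A) :=
  isSelfAdjoint_cfc_ofReal _ _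

theorem isSelfAdjoint_sqrtMulInvSqrtShift (A : H →ₗ.[ℂ] H) :
    IsSelfAdjoint (sqrtMulInvSqrtShift A) :=
  isSelfAdjoint_cfc_ofReal (fun r => √(1 - invSqrtShiftFun r ^ 2)) _

theorem invSqrtShiftFun_zero : invSqrtShiftFun 0 = 0 := by simp [invSqrtShiftFun]

/-- Parametrizes the spectrum by `s ≥ 0`, the extra point `r = 0` standing for `s = ∞`. The
identities below are checked in this parameter. -/
theorem eq_zero_or_inv_eq_of_mem_spectrum {A : H →ₗ.[ℂ] H} (hA : IsSelfAdjoint A)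
    (hpos : OpNonneg A) {r : ℂ} (hr : r ∈ spectrum ℂ (resolventI A)) :
    r = 0 ∨ (r ≠ 0 ∧ 0 ≤ (r⁻¹).re ∧ r⁻¹ = (r⁻¹).re + Complex.I ∧
      invSqrtShiftFun r ^ 2 = (1 + (r⁻¹).re)⁻¹) := by
  by_cases h0 : r = 0
  · exact Or.inl h0
  refine Or.inr ⟨h0, ?_⟩
  have him := im_eq_of_mem_spectrum_resolventI hA hr
  have hre := re_nonneg_of_mem_spectrum_resolventI hA hpos hr
  have hn : 0 < ‖r‖ := norm_pos_iff.2 h0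
  have hs : (r⁻¹).re = r.re / ‖r‖ ^ 2 := by rw [Complex.inv_re, Complex.normSq_eq_norm_sq]
  have hs0 : 0 ≤ (r⁻¹).re := by rw [hs]; positivity
  have hi : (r⁻¹).im = 1 := by
    rw [Complex.inv_im, Complex.normSq_eq_norm_sq, him]
    field_simp
  refine ⟨hs0, Complex.ext (by simp) (by simp [hi]), ?_⟩
  have h1 : r.re / ‖r‖ = (r⁻¹).re * ‖r‖ := by
    rw [hs]
    field_simp
  have h2 : ‖r‖ ^ 2 * ((r⁻¹).re ^ 2 + 1) = 1 := by
    have e : ‖r⁻¹‖ ^ 2 = (r⁻¹).re ^ 2 + 1 := by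
      rw [← Complex.normSq_eq_norm_sq, Complex.normSq_apply, hi]
      ring
    rw [← e, norm_inv]
    field_simp
  set s := (r⁻¹).re
  -- Equivalent to `1 + s² ≤ (1 + s)²`.
  have h3 : 1 ≤ ‖r‖ + s * ‖r‖ := by
    have : 0 ≤ ‖r‖ + s * ‖r‖ := by positivity
    nlinarith [mul_nonneg hs0 (sq_nonneg ‖r‖)]
  rw [invSqrtShiftFun, Real.sq_sqrt (div_nonneg hn.le (zero_le_one.trans (le_max_left _ _))), h1,
    max_eq_right h3]
  have : 0 < 1 + s := by linarith
  field_simp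

theorem continuous_ofReal_invSqrtShiftFun : Continuous fun r : ℂ => (invSqrtShiftFun r : ℂ) :=
  Complex.continuous_ofReal.comp continuous_invSqrtShiftFun

theorem continuous_ofReal_sqrtMulInvSqrtShiftFun :
    Continuous fun r : ℂ => (√(1 - invSqrtShiftFun r ^ 2) : ℂ) := by
  have := continuous_invSqrtShiftFun
  exact Complex.continuous_ofReal.comp (by fun_prop)

theorem continuous_ofReal_weighted_sqrtAbs :
    Continuous fun r : ℂ => ((√|(r⁻¹).re| * ‖r‖ : ℝ) : ℂ) :=
  Complex.continuous_ofReal.comp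
    (continuous_weighted_fun (f := fun s => √|s|) (by fun_prop) abs_sqrt_abs_le)

theorem invSqrtShift_sq_add {A : H →ₗ.[ℂ] H} (hA : IsSelfAdjoint A) (hpos : OpNonneg A) :
    invSqrtShift A * invSqrtShift A + sqrtMulInvSqrtShift A * sqrtMulInvSqrtShift A = 1 := by
  have hN := isStarNormal_resolventI hA
  have c1 := continuous_ofReal_invSqrtShiftFun
  have c2 := continuous_ofReal_sqrtMulInvSqrtShiftFun
  rw [invSqrtShift, sqrtMulInvSqrtShift, cfc_mul_cfc_of_continuous c1 c1,
    cfc_mul_cfc_of_continuous c2 c2,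
    cfc_add_cfc_of_continuous (by exact c1.mul c1) (by exact c2.mul c2),
    ← cfc_const_one ℂ (resolventI A)]
  refine cfc_congr fun r hr => ?_
  have h1 : 0 ≤ 1 - invSqrtShiftFun r ^ 2 := by
    rcases eq_zero_or_inv_eq_of_mem_spectrum hA hpos hr with rfl | ⟨-, h0, -, h⟩
    · simp [invSqrtShiftFun_zero]
    · rw [h, sub_nonneg]
      exact inv_le_one_of_one_le₀ (by linarith)
  simp only [← Complex.ofReal_mul, ← Complex.ofReal_add]
  rw [Real.mul_self_sqrt h1]
  norm_num
  ring

theorem weighted_mul_invSqrtShift {A : H →ₗ.[ℂ] H} (hA : IsSelfAdjoint A) (hpos : OpNonneg A) :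
    weighted (fun s => √|s|) A * invSqrtShift A = weight A * sqrtMulInvSqrtShift A := by
  have c1 := continuous_ofReal_invSqrtShiftFun
  have c2 := continuous_ofReal_sqrtMulInvSqrtShiftFun
  have c3 := continuous_ofReal_weighted_sqrtAbs
  have c4 : Continuous fun r : ℂ => ((‖r‖ : ℝ) : ℂ) := by fun_prop
  rw [invSqrtShift, sqrtMulInvSqrtShift, weighted, weight, cfc_mul_cfc_of_continuous c3 c1,
    cfc_mul_cfc_of_continuous c4 c2]
  refine cfc_congr fun r hr => ?_
  rcases eq_zero_or_inv_eq_of_mem_spectrum hA hpos hr with rfl | ⟨-, h0, -, h⟩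
  · simp
  have hg : invSqrtShiftFun r = √((1 + (r⁻¹).re)⁻¹) := by
    rw [← h, Real.sqrt_sq (show 0 ≤ invSqrtShiftFun r from Real.sqrt_nonneg _)]
  simp only [← Complex.ofReal_mul]
  congr 1
  rw [h, hg, abs_of_nonneg h0, mul_right_comm, ← Real.sqrt_mul h0, mul_comm]
  congr 2
  have : 0 < 1 + (r⁻¹).re := by linarith
  generalize (r⁻¹).re = s at this
  field_simp
  ring

/-- Up to the weight, this is `(1 + s)⁻¹ + (1 + s)^{-1/2} (s / (1 + s))^{1/2} s^{1/2} = 1`. It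
writes `x` in the domain of `A^{1/2}` as an element of the range of `(A + 1)^{-1/2}`. -/
theorem weight_mul_invSqrtShift_sq_add {A : H →ₗ.[ℂ] H} (hA : IsSelfAdjoint A)
    (hpos : OpNonneg A) :
    weight A * (invSqrtShift A * invSqrtShift A)
      + invSqrtShift A * sqrtMulInvSqrtShift A * weighted (fun s => √|s|) A = weight A := by
  have c1 := continuous_ofReal_invSqrtShiftFun
  have c2 := continuous_ofReal_sqrtMulInvSqrtShiftFun
  have c3 := continuous_ofReal_weighted_sqrtAbs
  have c4 : Continuous fun r : ℂ => ((‖r‖ : ℝ) : ℂ) := by fun_prop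
  rw [invSqrtShift, sqrtMulInvSqrtShift, weighted, weight, cfc_mul_cfc_of_continuous c1 c1,
    cfc_mul_cfc_of_continuous c1 c2, cfc_mul_cfc_of_continuous c4 (by exact c1.mul c1),
    cfc_mul_cfc_of_continuous (by exact c1.mul c2) c3,
    cfc_add_cfc_of_continuous (by exact c4.mul (c1.mul c1)) (by exact (c1.mul c2).mul c3)]
  refine cfc_congr fun r hr => ?_
  rcases eq_zero_or_inv_eq_of_mem_spectrum hA hpos hr with rfl | ⟨-, h0, -, h⟩
  · simp
  set s := (r⁻¹).re
  have hs : 0 < 1 + s := by linarith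
  have hg : invSqrtShiftFun r = √((1 + s)⁻¹) := by
    rw [← h, Real.sqrt_sq (show 0 ≤ invSqrtShiftFun r from Real.sqrt_nonneg _)]
  simp only [← Complex.ofReal_mul, ← Complex.ofReal_add]
  congr 1
  have h1 : 1 - invSqrtShiftFun r ^ 2 = s * (1 + s)⁻¹ := by
    rw [h]
    field_simp
    ring
  have h2 := Real.mul_self_sqrt h0
  have h3 := Real.mul_self_sqrt (inv_nonneg.2 hs.le)
  rw [h1, Real.sqrt_mul h0, abs_of_nonneg h0, hg]
  have h4 : (1 + s) * (1 + s)⁻¹ = 1 := mul_inv_cancel₀ hs.ne'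
  linear_combination ‖r‖ * ((1 + √s * √s) * h3 + (1 + s)⁻¹ * h2 + h4)

/-- The resolvent identity between `(A + i)⁻¹` and `(A + 1)⁻¹`; it identifies the square of
`invSqrtShift A` with the latter. -/
theorem resolventI_mul_invSqrtShift_sq {A : H →ₗ.[ℂ] H} (hA : IsSelfAdjoint A)
    (hpos : OpNonneg A) :
    resolventI A + (Complex.I - 1) • (resolventI A * (invSqrtShift A * invSqrtShift A))
      = invSqrtShift A * invSqrtShift A := by
  have hN := isStarNormal_resolventI hA
  have c1 := continuous_ofReal_invSqrtShiftFun
  have c0 : Continuous fun r : ℂ => r := continuous_id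
  have hid := (cfc_id' ℂ (resolventI A)).symm
  set P := invSqrtShift A * invSqrtShift A with hP
  have hP' : P = cfc (fun r : ℂ => (invSqrtShiftFun r : ℂ) * (invSqrtShiftFun r : ℂ))
    (resolventI A) := by rw [hP, invSqrtShift, cfc_mul_cfc_of_continuous c1 c1]
  have h1 : resolventI A * P = cfc (fun r : ℂ => r *
      ((invSqrtShiftFun r : ℂ) * (invSqrtShiftFun r : ℂ))) (resolventI A) := by
    rw [hP', ← cfc_mul_cfc_of_continuous c0 (by exact c1.mul c1), ← hid]
  have h2 : resolventI A + (Complex.I - 1) • (resolventI A * P) = cfc (fun r : ℂ => r +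
      (Complex.I - 1) * (r * ((invSqrtShiftFun r : ℂ) * (invSqrtShiftFun r : ℂ))))
      (resolventI A) := by
    rw [← cfc_add_cfc_of_continuous c0 (by exact continuous_const.mul (c0.mul (c1.mul c1))),
      ← hid, cfc_const_mul _ _ _ (by exact (c0.mul (c1.mul c1)).continuousOn), h1]
  rw [h2, hP']
  refine cfc_congr fun r hr => ?_
  rcases eq_zero_or_inv_eq_of_mem_spectrum hA hpos hr with rfl | ⟨hr0, h0, hi, h⟩
  · simp [invSqrtShiftFun_zero]
  rw [← pow_two, ← Complex.ofReal_pow, h]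
  have hs : (((1 + (r⁻¹).re : ℝ)) : ℂ) ≠ 0 := by
    rw [Complex.ofReal_ne_zero]; linarith
  generalize (r⁻¹).re = s at hi hs
  have hr1 : r * (s + Complex.I) = 1 := by rw [← hi, mul_inv_cancel₀ hr0]
  push_cast at hs ⊢
  field_simp
  linear_combination hr1

theorem invSqrtShift_injective {A : H →ₗ.[ℂ] H} (hA : IsSelfAdjoint A) (hpos : OpNonneg A) :
    Function.Injective (invSqrtShift A) := by
  refine (injective_iff_map_eq_zero _).2 fun x hx => resolventI_injective hA ?_
  have h := congrArg (fun L : H →L[ℂ] H => L x) (resolventI_mul_invSqrtShift_sq hA hpos)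
  simpa [hx] using h

theorem mem_graph_invSqrtShift_sq {A : H →ₗ.[ℂ] H} (hA : IsSelfAdjoint A) (hpos : OpNonneg A)
    (w : H) : (invSqrtShift A (invSqrtShift A w),
      w - invSqrtShift A (invSqrtShift A w)) ∈ A.graph := by
  have h := congrArg (fun L : H →L[ℂ] H => L w) (resolventI_mul_invSqrtShift_sq hA hpos)
  simp only [add_apply, smul_apply, mul_apply_eq_comp] at h
  rw [← map_smul, ← map_add, resolventI_apply_eq_iff hA] at h
  convert! h using 2
  rw [sub_smul, one_smul]
  abel

/-- The two candidates for the solution `v` of `A v + v = y + x` differ by some `u` with `A u = -u`,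
and `A ≥ 0` forces `u = 0`. -/
theorem invSqrtShift_sq_apply_add {A : H →ₗ.[ℂ] H} (hA : IsSelfAdjoint A) (hpos : OpNonneg A)
    {x y : H} (h : (x, y) ∈ A.graph) : invSqrtShift A (invSqrtShift A (y + x)) = x := by
  set v := invSqrtShift A (invSqrtShift A (y + x)) with hv
  have h1 := A.graph.sub_mem (mem_graph_invSqrtShift_sq hA hpos (y + x)) h
  rw [← hv, Prod.mk_sub_mk] at h1
  have h2 : y + x - v - y = -(v - x) := by abel
  rw [h2] at h1
  obtain ⟨u, hu1, hu2⟩ := A.mem_graph_iff.1 h1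
  simp only at hu1 hu2
  have h3 := hpos u
  rw [hu2, hu1, inner_neg_right, inner_self_eq_norm_sq_to_K] at h3
  simp only [Complex.neg_re, ← Complex.ofReal_pow, Complex.coe_algebraMap,
    Complex.ofReal_re] at h3
  have h4 : ‖v - x‖ = 0 := by
    have := sq_nonneg ‖v - x‖
    exact pow_eq_zero_iff (two_ne_zero) |>.1 (by linarith)
  exact sub_eq_zero.1 (norm_eq_zero.1 h4)

theorem weighted_sqrtAbs_invSqrtShift {A : H →ₗ.[ℂ] H} (hA : IsSelfAdjoint A)
    (hpos : OpNonneg A) (u : H) : weighted (fun s => √|s|) A (invSqrtShift A u)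
      = weight A (sqrtMulInvSqrtShift A u) :=
  congrArg (fun L : H →L[ℂ] H => L u) (weighted_mul_invSqrtShift hA hpos)

theorem mem_sqrtAbs_domain_iff {A : H →ₗ.[ℂ] H} (hA : IsSelfAdjoint A) (hpos : OpNonneg A)
    {x : H} : x ∈ (sqrtAbs A).domain ↔ ∃ u, invSqrtShift A u = x := by
  constructor
  · intro hx
    obtain ⟨y, hy⟩ := mem_funCalc_domain.1 hx
    -- Here `y = A^{1/2} x`, and the witness is `(A + 1)^{1/2} x = (A + 1)^{-1/2} x + A^{1/2} (A +
    -- 1)^{-1/2} A^{1/2} x`.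
    refine ⟨invSqrtShift A x + sqrtMulInvSqrtShift A y, weight_injective hA ?_⟩
    have h := congrArg (fun L : H →L[ℂ] H => L x) (weight_mul_invSqrtShift_sq_add hA hpos)
    simp only [add_apply, mul_apply_eq_comp] at h
    rw [hy] at h
    have hc1 : sqrtMulInvSqrtShift A (weight A y) = weight A (sqrtMulInvSqrtShift A y) :=
      congrArg (fun L : H →L[ℂ] H => L y) (cfc_commute_cfc _ _ (resolventI A)).eq
    have hc2 : ∀ z, invSqrtShift A (weight A z) = weight A (invSqrtShift A z) := fun z =>
      congrArg (fun L : H →L[ℂ] H => L z) (cfc_commute_cfc _ _ (resolventI A)).eq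
    rw [hc1, hc2] at h
    rw [map_add, map_add]
    exact h
  · rintro ⟨u, rfl⟩
    exact mem_funCalc_domain.2 ⟨_, weighted_sqrtAbs_invSqrtShift hA hpos u⟩

theorem weighted_sqrtPos_eq {A : H →ₗ.[ℂ] H} (hA : IsSelfAdjoint A) (hpos : OpNonneg A) :
    weighted (fun s => √(max s 0)) A = weighted (fun s => √|s|) A := by
  refine cfc_congr fun r hr => ?_
  rcases eq_zero_or_inv_eq_of_mem_spectrum hA hpos hr with rfl | ⟨-, h0, -, -⟩
  · simp
  · simp only
    rw [max_eq_left h0, abs_of_nonneg h0]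

theorem weighted_sqrtNeg_eq {A : H →ₗ.[ℂ] H} (hA : IsSelfAdjoint A) (hpos : OpNonneg A) :
    weighted (fun s => √(max (-s) 0)) A = 0 := by
  rw [← cfc_const_zero ℂ (resolventI A)]
  refine cfc_congr fun r hr => ?_
  rcases eq_zero_or_inv_eq_of_mem_spectrum hA hpos hr with rfl | ⟨-, h0, -, -⟩
  · simp
  · simp only
    rw [max_eq_right (by linarith)]
    simp

theorem formOf_invSqrtShift {A : H →ₗ.[ℂ] H} (hA : IsSelfAdjoint A) (hpos : OpNonneg A)
    {u v : H} (hu : invSqrtShift A u ∈ (formOf A).domain)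
    (hv : invSqrtShift A v ∈ (formOf A).domain) :
    (formOf A).toFun ⟨invSqrtShift A u, hu⟩ ⟨invSqrtShift A v, hv⟩
      = inner ℂ v u - inner ℂ (invSqrtShift A v) (invSqrtShift A u) := by
  have hP : ∀ w (hw : invSqrtShift A w ∈ (sqrtPos A).domain),
      sqrtPos A ⟨invSqrtShift A w, hw⟩ = sqrtMulInvSqrtShift A w := fun w hw =>
    funCalc_eq hA _ _ (by
      rw [weighted_sqrtPos_eq hA hpos]
      exact weighted_sqrtAbs_invSqrtShift hA hpos w)
  have hM : ∀ w (hw : invSqrtShift A w ∈ (sqrtNeg A).domain),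
      sqrtNeg A ⟨invSqrtShift A w, hw⟩ = 0 := fun w hw =>
    funCalc_eq hA _ _ (by
      rw [weighted_sqrtNeg_eq hA hpos]
      simp)
  have e1 : (formOf A).toFun ⟨invSqrtShift A u, hu⟩ ⟨invSqrtShift A v, hv⟩
      = inner ℂ (sqrtPos A ⟨invSqrtShift A v, sqrtAbs_domain_le_pos A hv⟩)
          (sqrtPos A ⟨invSqrtShift A u, sqrtAbs_domain_le_pos A hu⟩)
        - inner ℂ (sqrtNeg A ⟨invSqrtShift A v, sqrtAbs_domain_le_neg A hv⟩)
          (sqrtNeg A ⟨invSqrtShift A u, sqrtAbs_domain_le_neg A hu⟩) := rfl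
  rw [e1, hP, hP, hM, hM, inner_zero_left, sub_zero,
    inner_map_comm_of_isSelfAdjoint (isSelfAdjoint_sqrtMulInvSqrtShift A),
    inner_map_comm_of_isSelfAdjoint (isSelfAdjoint_invSqrtShift A)]
  have h := congrArg (fun L : H →L[ℂ] H => inner ℂ v (L u)) (invSqrtShift_sq_add hA hpos)
  simp only [add_apply, mul_apply_eq_comp, inner_add_right, one_apply_eq_self] at h
  linear_combination h

/-! ### Weakly null sequences and relative form compactness -/

theorem WeaklyNull.map {x : ℕ → H} (hx : WeaklyNull x) (L : H →L[ℂ] H) :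
    WeaklyNull fun n => L (x n) := fun y => by
  simpa only [ContinuousLinearMap.adjoint_inner_left] using hx (ContinuousLinearMap.adjoint L y)

/-- Along any subsequence, compactness yields a further norm-convergent one; its limit is also the
weak limit, which is `0`. -/
theorem WeaklyNull.tendsto_of_isCompactOperator {x : ℕ → H} (hx : WeaklyNull x) {C : ℝ}
    (hC : ∀ n, ‖x n‖ ≤ C) {K : H →L[ℂ] H} (hK : IsCompactOperator K) :
    Tendsto (fun n => K (x n)) atTop (𝓝 0) := by
  refine tendsto_of_subseq_tendsto fun ns hns => ?_
  have hcomp := hK.isCompact_closure_image_closedBall C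
  obtain ⟨w, -, φ, hφ, hw⟩ := hcomp.tendsto_subseq (x := fun n => K (x (ns n))) fun n =>
    subset_closure ⟨x (ns n), by simpa using hC (ns n), rfl⟩
  refine ⟨φ, ?_⟩
  have h1 : Tendsto (fun n => inner ℂ w (K (x (ns (φ n))))) atTop (𝓝 (inner ℂ w w)) :=
    tendsto_const_nhds.inner hw
  have h2 := ((hx.map K) w).comp (hns.comp hφ.tendsto_atTop)
  have h3 : w = 0 := inner_self_eq_zero.1 (tendsto_nhds_unique h1 h2)
  rw [← h3]
  exact hw

/-- Two applications of Cauchy–Schwarz: `‖C* C x‖² = ⟨C x, (C C*) C x⟩` tends to `0`, hence so does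
`‖C x‖² = ⟨C* C x, x⟩`. -/
theorem WeaklyNull.tendsto_of_isCompactOperator_mul_star {x : ℕ → H} (hx : WeaklyNull x) {b : ℝ}
    (hb : ∀ n, ‖x n‖ ≤ b) {C : H →L[ℂ] H} (hC : IsCompactOperator (C * star C)) :
    Tendsto (fun n => C (x n)) atTop (𝓝 0) := by
  have hb0 : 0 ≤ b := (norm_nonneg _).trans (hb 0)
  have hCb : ∀ n, ‖C (x n)‖ ≤ ‖C‖ * b := fun n =>
    (C.le_opNorm _).trans (mul_le_mul_of_nonneg_left (hb n) (norm_nonneg C))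
  have h1 := (hx.map C).tendsto_of_isCompactOperator hCb hC
  have hinner : ∀ u v, inner ℂ (star C u) v = inner ℂ u (C v) := fun u v => by
    rw [ContinuousLinearMap.star_eq_adjoint, ContinuousLinearMap.adjoint_inner_left]
  have h2 : Tendsto (fun n => ‖star C (C (x n))‖) atTop (𝓝 0) := by
    have h3 : Tendsto (fun n => ‖star C (C (x n))‖ ^ 2) atTop (𝓝 0) := by
      refine squeeze_zero (fun n => sq_nonneg _) (fun n => ?_)
        (by simpa using h1.norm.const_mul (‖C‖ * b))
      have e : ((‖star C (C (x n))‖ ^ 2 : ℝ) : ℂ)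
          = inner ℂ (C (x n)) ((C * star C) (C (x n))) := by
        rw [mul_apply_eq_comp, ← hinner, inner_self_eq_norm_sq_to_K]
        simp
      have e2 : ‖star C (C (x n))‖ ^ 2 = ‖inner ℂ (C (x n)) ((C * star C) (C (x n)))‖ := by
        rw [← e, Complex.norm_real, Real.norm_eq_abs, abs_of_nonneg (sq_nonneg _)]
      rw [e2]
      exact (norm_inner_le_norm _ _).trans (mul_le_mul_of_nonneg_right (hCb n) (norm_nonneg _))
    simpa using h3.sqrt
  have h4 : Tendsto (fun n => ‖C (x n)‖ ^ 2) atTop (𝓝 0) := by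
    refine squeeze_zero (fun n => sq_nonneg _) (fun n => ?_) (by simpa using h2.mul_const b)
    have e : ((‖C (x n)‖ ^ 2 : ℝ) : ℂ) = inner ℂ (star C (C (x n))) (x n) := by
      rw [hinner, inner_self_eq_norm_sq_to_K]
      simp
    have e2 : ‖C (x n)‖ ^ 2 = ‖inner ℂ (star C (C (x n))) (x n)‖ := by
      rw [← e, Complex.norm_real, Real.norm_eq_abs, abs_of_nonneg (sq_nonneg _)]
    rw [e2]
    exact (norm_inner_le_norm _ _).trans (mul_le_mul_of_nonneg_left (hb n) (norm_nonneg _))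
  rw [tendsto_zero_iff_norm_tendsto_zero]
  simpa using h4.sqrt

/-- If a bounded operator `S` maps into the domain of `f(T)`, then `f(T) S` is bounded. -/
theorem exists_funCalc_comp {T : H →ₗ.[ℂ] H} (hT : IsSelfAdjoint T) (f : ℝ → ℝ) (S : H →L[ℂ] H)
    (h : ∀ u, S u ∈ (funCalc f T).domain) :
    ∃ C : H →L[ℂ] H, ∀ u, funCalc f T ⟨S u, h u⟩ = C u := by
  let L : H →ₗ[ℂ] H := (funCalc f T).toFun ∘ₗ S.toLinearMap.codRestrict _ h
  -- The closed graph theorem applies: the graph is cut out by an equation between bounded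
  -- operators.
  have hclosed : IsClosed (L.graph : Set (H × H)) := by
    have e : (L.graph : Set (H × H)) = {p | weighted f T (S p.1) = weight T p.2} := by
      ext p
      have hp := weight_funCalc hT f ⟨S p.1, h p.1⟩
      simp only [SetLike.mem_coe, LinearMap.mem_graph_iff, Set.mem_ofPred_eq]
      change p.2 = funCalc f T ⟨S p.1, h p.1⟩ ↔ _
      constructor
      · intro hq
        rw [hq, hp]
      · intro hq
        exact (funCalc_eq hT f ⟨S p.1, h p.1⟩ hq).symm
    rw [e]
    exact isClosed_eq (by fun_prop) (by fun_prop)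
  exact ⟨⟨L, L.continuous_of_isClosed_graph hclosed⟩, fun u => rfl⟩

/-- The form of a relatively `A`-form compact operator `B`, transported by `(A + 1)^{-1/2}`, is the
form of a bounded self-adjoint operator that maps bounded weakly null sequences to null sequences. -/
theorem exists_transported_form {A B : H →ₗ.[ℂ] H} (hA : IsSelfAdjoint A) (hB : IsSelfAdjoint B)
    (hpos : OpNonneg A) (hdom : (sqrtAbs A).domain ≤ (sqrtAbs B).domain)
    (hcompact : IsRelFormCompact A B) :
    ∃ G : H →L[ℂ] H, IsSelfAdjoint G ∧
      (∀ (x : ℕ → H) (b : ℝ), WeaklyNull x → (∀ n, ‖x n‖ ≤ b) →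
        Tendsto (fun n => G (x n)) atTop (𝓝 0)) ∧
      ∀ u v (hu : invSqrtShift A u ∈ (formOf B).domain)
        (hv : invSqrtShift A v ∈ (formOf B).domain),
        (formOf B).toFun ⟨invSqrtShift A u, hu⟩ ⟨invSqrtShift A v, hv⟩ = inner ℂ v (G u) := by
  set S := invSqrtShift A with hS
  have hSsa := isSelfAdjoint_invSqrtShift A
  have hmem : ∀ u, S u ∈ (sqrtAbs B).domain := fun u =>
    hdom ((mem_sqrtAbs_domain_iff hA hpos).2 ⟨u, rfl⟩)
  obtain ⟨C, hC⟩ := exists_funCalc_comp hB (fun s => √|s|) S hmem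
  obtain ⟨P, hP⟩ := exists_funCalc_comp hB (fun s => √(max s 0)) S
    fun u => sqrtAbs_domain_le_pos B (hmem u)
  obtain ⟨N, hN⟩ := exists_funCalc_comp hB (fun s => √(max (-s) 0)) S
    fun u => sqrtAbs_domain_le_neg B (hmem u)
  have hpyth : ∀ u, ‖P u‖ ^ 2 + ‖N u‖ ^ 2 = ‖C u‖ ^ 2 := fun u => by
    rw [← hC, ← hP, ← hN]
    exact norm_sqrtPos_sq_add_norm_sqrtNeg_sq hB ⟨S u, hmem u⟩
  obtain ⟨K, hKc, hK⟩ := hcompact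
  -- On the domain of `|B|^{1/2}` the adjoint of `C = |B|^{1/2} S` is `S |B|^{1/2}`. Hence `C C*` is
  -- `|B|^{1/2} (A + 1)⁻¹ |B|^{1/2}` there, and equals `K` everywhere by density.
  have hstar : ∀ x : (sqrtAbs B).domain, star C x = S (sqrtAbs B x) := fun x => by
    refine ext_inner_left ℂ fun u => ?_
    rw [ContinuousLinearMap.star_eq_adjoint, ContinuousLinearMap.adjoint_inner_right, ← hC,
      ← inner_map_comm_of_isSelfAdjoint hSsa]
    exact inner_funCalc_comm hB _ ⟨S u, hmem u⟩ x
  have hCC : ∀ x : (sqrtAbs B).domain, (C * star C) x = K x := fun x => by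
    rw [mul_apply_eq_comp, hstar, ← hC]
    have hg := mem_graph_invSqrtShift_sq hA hpos (sqrtAbs B x)
    obtain ⟨v, hv1, hv2⟩ := A.mem_graph_iff.1 hg
    simp only [← hS] at hv1 hv2
    have h1 := hK x v (by rw [hv2, hv1]; abel) (hv1 ▸ hmem _)
    rw [← h1]
    change sqrtAbs B _ = _
    congr 1
    exact Subtype.ext hv1.symm
  have hCK : C * star C = K := by
    refine ContinuousLinearMap.coeFn_injective ?_
    refine Continuous.ext_on (dense_funCalc_domain hB fun s => √|s|) (C * star C).continuous
      K.continuous fun x hx => hCC ⟨x, hx⟩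
  refine ⟨star P * P - star N * N, ?_, ?_, ?_⟩
  · exact (IsSelfAdjoint.star_mul_self P).sub (IsSelfAdjoint.star_mul_self N)
  · intro x b hx hb
    have h1 : Tendsto (fun n => C (x n)) atTop (𝓝 0) :=
      hx.tendsto_of_isCompactOperator_mul_star hb (hCK ▸ hKc)
    -- The identity `‖P u‖² + ‖N u‖² = ‖C u‖²` lets `C` dominate both `P` and `N`.
    have h2 : Tendsto (fun n => P (x n)) atTop (𝓝 0) := by
      refine squeeze_zero_norm (fun n => ?_) (by simpa using h1.norm)
      exact abs_le_of_sq_le_sq' (by nlinarith [hpyth (x n), sq_nonneg ‖N (x n)‖])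
        (norm_nonneg _) |>.2
    have h3 : Tendsto (fun n => N (x n)) atTop (𝓝 0) := by
      refine squeeze_zero_norm (fun n => ?_) (by simpa using h1.norm)
      exact abs_le_of_sq_le_sq' (by nlinarith [hpyth (x n), sq_nonneg ‖P (x n)‖])
        (norm_nonneg _) |>.2
    have h4 := ((star P).continuous.tendsto 0).comp h2
    have h5 := ((star N).continuous.tendsto 0).comp h3
    simpa using h4.sub h5
  · intro u v hu hv
    have e1 : (formOf B).toFun ⟨S u, hu⟩ ⟨S v, hv⟩ = inner ℂ (P v) (P u) - inner ℂ (N v) (N u) := by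
      rw [← hP, ← hP, ← hN, ← hN]
      rfl
    rw [e1]
    simp only [sub_apply, mul_apply_eq_comp, inner_sub_right, ContinuousLinearMap.star_eq_adjoint,
      ContinuousLinearMap.adjoint_inner_right]

/-! ### Perturbation of a closed form by a form compact one -/

/-- `S` plays the role of `(A + 1)^{-1/2}`, and `G` that of the bounded operator of the form
`𝔟[S ·, S ·]`. -/
structure IsCompactPair (S G : H →L[ℂ] H) : Prop where
  isSelfAdjoint_left : IsSelfAdjoint S
  injective_left : Function.Injective S
  norm_left_le : ∀ u, ‖S u‖ ≤ ‖u‖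
  isSelfAdjoint_right : IsSelfAdjoint G
  tendsto_right : ∀ (x : ℕ → H) (b : ℝ), WeaklyNull x → (∀ n, ‖x n‖ ≤ b) →
    Tendsto (fun n => G (x n)) atTop (𝓝 0)

/-- The form `q` has the domain `Ran S` and `q[S u, S v] = ⟨u, v⟩ - ⟨S u, S v⟩ + z ⟨G u, v⟩`. -/
structure SesqForm.IsTransport (q : SesqForm H) (S G : H →L[ℂ] H) (z : ℂ) : Prop where
  mem_domain_iff : ∀ {x : H}, x ∈ q.domain ↔ ∃ u, S u = x
  apply_eq : ∀ (x y : q.domain) (u v : H), S u = x → S v = y →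
    q.toFun x y = inner ℂ v u - inner ℂ (S v) (S u) + z * inner ℂ v (G u)

theorem SesqForm.IsTransport.quad_eq {H : Type*} [NormedAddCommGroup H]
    [InnerProductSpace ℂ H] {q : SesqForm H} {S G : H →L[ℂ] H} {z : ℂ}
    (hq : q.IsTransport S G z) (x : q.domain) {u : H} (hu : S u = x) :
    q.quad x = ((‖u‖ ^ 2 - ‖S u‖ ^ 2 : ℝ) : ℂ) + z * inner ℂ u (G u) := by
  rw [SesqForm.quad, hq.apply_eq x x u u hu hu, inner_self_eq_norm_sq_to_K,
    inner_self_eq_norm_sq_to_K]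
  simp

namespace IsCompactPair

variable {S G : H →L[ℂ] H}

theorem denseRange_left (h : IsCompactPair S G) : DenseRange S :=
  denseRange_of_isSelfAdjoint_of_injective h.isSelfAdjoint_left h.injective_left

/-- For a bounded sequence it suffices to test against the dense range of `S`, where `⟨S u, y n⟩ =
⟨u, S (y n)⟩`. -/
theorem weaklyNull_of_map (h : IsCompactPair S G) {y : ℕ → H} {b : ℝ} (hb : ∀ n, ‖y n‖ ≤ b)
    (hy : WeaklyNull fun n => S (y n)) : WeaklyNull y := by
  intro v
  rw [Metric.tendsto_atTop]
  intro ε hε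
  have hb0 : 0 ≤ b := (norm_nonneg _).trans (hb 0)
  obtain ⟨u, hu⟩ := h.denseRange_left.exists_dist_lt v (show 0 < ε / (2 * (b + 1)) by positivity)
  obtain ⟨N, hN⟩ := Metric.tendsto_atTop.1 (hy u) (ε / 2) (by positivity)
  refine ⟨N, fun n hn => ?_⟩
  have h1 := hN n hn
  rw [dist_zero_right, ← inner_map_comm_of_isSelfAdjoint h.isSelfAdjoint_left] at h1
  rw [dist_eq_norm, lt_div_iff₀ (by positivity)] at hu
  rw [dist_zero_right]
  have h2 : inner ℂ v (y n) = inner ℂ (S u) (y n) + inner ℂ (v - S u) (y n) := by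
    rw [inner_sub_left]; ring
  have h3 : ‖inner ℂ (v - S u) (y n)‖ ≤ ‖v - S u‖ * (b + 1) :=
    (norm_inner_le_norm _ _).trans (mul_le_mul_of_nonneg_left
      ((hb n).trans (by linarith)) (norm_nonneg _))
  rw [h2]
  linarith [norm_add_le (inner ℂ (S u) (y n)) (inner ℂ (v - S u) (y n))]

/-- If no `M` works, there are unit vectors with `ε + n ‖S y_n‖² < |⟨y_n, G y_n⟩| ≤ ‖G‖`. Then `S
y_n → 0`, so `y_n` is weakly null and `G y_n → 0`, against the lower bound `ε`. -/
theorem exists_form_bound (h : IsCompactPair S G) {ε : ℝ} (hε : 0 < ε) :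
    ∃ M : ℝ, 0 ≤ M ∧ ∀ u, ‖inner ℂ u (G u)‖ ≤ ε * ‖u‖ ^ 2 + M * ‖S u‖ ^ 2 := by
  by_contra! hcon
  have h1 : ∀ n : ℕ, ∃ y : H, ‖y‖ = 1 ∧ ε + n * ‖S y‖ ^ 2 < ‖inner ℂ y (G y)‖ := fun n => by
    obtain ⟨u, hu⟩ := hcon n n.cast_nonneg
    have hu0 : u ≠ 0 := by
      rintro rfl
      simp at hu
    have hn : 0 < ‖u‖ := norm_pos_iff.2 hu0
    have hc : ‖((‖u‖⁻¹ : ℝ) : ℂ)‖ = ‖u‖⁻¹ := by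
      rw [Complex.norm_real, Real.norm_eq_abs, abs_of_pos (by positivity)]
    refine ⟨((‖u‖⁻¹ : ℝ) : ℂ) • u, ?_, ?_⟩
    · rw [norm_smul, hc, inv_mul_cancel₀ hn.ne']
    · rw [map_smul, map_smul, norm_smul, inner_smul_left, inner_smul_right, norm_mul, norm_mul,
        RCLike.norm_conj, hc]
      have e : ε + n * (‖u‖⁻¹ * ‖S u‖) ^ 2
          = ‖u‖⁻¹ * (‖u‖⁻¹ * (ε * ‖u‖ ^ 2 + n * ‖S u‖ ^ 2)) := by
        field_simp
      rw [e]
      gcongr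
  choose y hy1 hy2 using h1
  have hG : ∀ n, ‖inner ℂ (y n) (G (y n))‖ ≤ ‖G (y n)‖ := fun n => by
    simpa [hy1 n] using norm_inner_le_norm (𝕜 := ℂ) (y n) (G (y n))
  have hS : Tendsto (fun n => S (y n)) atTop (𝓝 0) := by
    have h2 : Tendsto (fun n => ‖S (y n)‖ ^ 2) atTop (𝓝 0) := by
      have hlim : Tendsto (fun n : ℕ => ‖G‖ / (n : ℝ)) atTop (𝓝 0) :=
        tendsto_const_nhds.div_atTop tendsto_natCast_atTop_atTop
      refine squeeze_zero' (Eventually.of_forall fun n => sq_nonneg _) ?_ hlim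
      filter_upwards [eventually_gt_atTop 0] with n hn
      rw [le_div_iff₀ (by exact_mod_cast hn)]
      have := G.le_opNorm (y n)
      rw [hy1, mul_one] at this
      linarith [hy2 n, hG n]
    rw [tendsto_zero_iff_norm_tendsto_zero]
    simpa using h2.sqrt
  have hnull : WeaklyNull y := h.weaklyNull_of_map (b := 1) (fun n => (hy1 n).le) fun v => by
    simpa using (tendsto_const_nhds (x := v)).inner hS
  have hlim := (h.tendsto_right y 1 hnull fun n => (hy1 n).le).norm
  rw [norm_zero] at hlim
  obtain ⟨n, hn⟩ := (hlim.eventually_lt_const hε).exists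
  have : 0 ≤ (n : ℝ) * ‖S (y n)‖ ^ 2 := by positivity
  linarith [hy2 n, hG n]

theorem exists_mul_bound (h : IsCompactPair S G) (z : ℂ) :
    ∃ M : ℝ, 0 ≤ M ∧ ∀ u, ‖z * inner ℂ u (G u)‖ ≤ 1 / 2 * ‖u‖ ^ 2 + M * ‖S u‖ ^ 2 := by
  obtain ⟨M, hM, hb⟩ := h.exists_form_bound (ε := 1 / (2 * (‖z‖ + 1))) (by positivity)
  refine ⟨‖z‖ * M, by positivity, fun u => ?_⟩
  rw [norm_mul]
  have h1 : ‖z‖ * (1 / (2 * (‖z‖ + 1))) ≤ 1 / 2 := by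
    have : 0 < ‖z‖ + 1 := by positivity
    rw [mul_one_div, div_le_iff₀ (by positivity)]
    linarith
  calc ‖z‖ * ‖inner ℂ u (G u)‖
      ≤ ‖z‖ * (1 / (2 * (‖z‖ + 1)) * ‖u‖ ^ 2 + M * ‖S u‖ ^ 2) := by
        gcongr
        exact hb u
    _ = ‖z‖ * (1 / (2 * (‖z‖ + 1))) * ‖u‖ ^ 2 + ‖z‖ * M * ‖S u‖ ^ 2 := by ring
    _ ≤ 1 / 2 * ‖u‖ ^ 2 + ‖z‖ * M * ‖S u‖ ^ 2 := by gcongr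

end IsCompactPair

namespace SesqForm.IsTransport

variable {q : SesqForm H} {S G : H →L[ℂ] H} {z : ℂ}

theorem isSectorial (hq : q.IsTransport S G z) (h : IsCompactPair S G) : q.IsSectorial := by
  obtain ⟨M, hM, hb⟩ := h.exists_mul_bound z
  -- For `‖S u‖ = 1` the shifted real part is at least `‖u‖² / 2 + M`, which also bounds the
  -- imaginary part; so the slope `1` suffices.
  refine ⟨((-(1 + 2 * M) : ℝ) : ℂ), 1, fun x hx => ?_⟩
  obtain ⟨u, hu⟩ := hq.mem_domain_iff.1 x.2
  have hb' := hb u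
  rw [hq.quad_eq x hu, hu, hx]
  rw [hu, hx] at hb'
  have h1 := (abs_le.1 (Complex.abs_re_le_norm (z * inner ℂ u (G u)))).1
  have h2 := Complex.abs_im_le_norm (z * inner ℂ u (G u))
  simp only [Complex.sub_re, Complex.add_re, Complex.sub_im, Complex.add_im, Complex.ofReal_re,
    Complex.ofReal_im, sub_zero, zero_add]
  constructor <;> nlinarith [sq_nonneg ‖u‖]

/-- The form norm controls the norm of the preimage under `S`. -/
theorem exists_norm_sq_le (hq : q.IsTransport S G z) (h : IsCompactPair S G) :
    ∃ c : ℝ, 0 ≤ c ∧ ∀ (x : q.domain) (u : H), S u = x →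
      ‖u‖ ^ 2 ≤ 2 * ‖q.quad x‖ + c * ‖(x : H)‖ ^ 2 := by
  obtain ⟨M, hM, hb⟩ := h.exists_mul_bound z
  refine ⟨2 * (1 + M), by positivity, fun x u hu => ?_⟩
  have h1 : ((‖u‖ ^ 2 - ‖S u‖ ^ 2 : ℝ) : ℂ) = q.quad x - z * inner ℂ u (G u) := by
    rw [hq.quad_eq x hu]; ring
  have h2 := norm_sub_le (q.quad x) (z * inner ℂ u (G u))
  rw [← h1, Complex.norm_real, Real.norm_eq_abs] at h2
  have h3 := le_abs_self (‖u‖ ^ 2 - ‖S u‖ ^ 2)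
  have h4 := hb u
  rw [hu] at h2 h3 h4
  linarith

theorem tendsto_quad {H : Type*} [NormedAddCommGroup H] [InnerProductSpace ℂ H]
    {q : SesqForm H} {S G : H →L[ℂ] H} (hq : q.IsTransport S G z) {ι : Type*}
    {l : Filter ι} (x : ι → q.domain) {u : ι → H} (hu : ∀ i, S (u i) = x i) (hlim : Tendsto u l (𝓝 0)) :
    Tendsto (fun i => q.quad (x i)) l (𝓝 0) := by
  have h1 : Continuous fun v : H => ((‖v‖ ^ 2 - ‖S v‖ ^ 2 : ℝ) : ℂ) + z * inner ℂ v (G v) := by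
    fun_prop
  have h2 := (h1.tendsto 0).comp hlim
  simp only [norm_zero, map_zero, inner_zero_left] at h2
  refine (h2.congr fun i => (hq.quad_eq (x i) (hu i)).symm).trans ?_
  simp

theorem tendsto_preimage (hq : q.IsTransport S G z) (h : IsCompactPair S G) {ι : Type*}
    {l : Filter ι} (x : ι → q.domain) {u : ι → H} (hu : ∀ i, S (u i) = x i)
    (hx : Tendsto (fun i => (x i : H)) l (𝓝 0)) (hqx : Tendsto (fun i => q.quad (x i)) l (𝓝 0)) :
    Tendsto u l (𝓝 0) := by
  obtain ⟨c, -, hc⟩ := hq.exists_norm_sq_le h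
  have h1 : Tendsto (fun i => ‖u i‖ ^ 2) l (𝓝 0) := by
    refine squeeze_zero (fun i => sq_nonneg _) (fun i => hc (x i) (u i) (hu i)) ?_
    simpa using (hqx.norm.const_mul 2).add ((hx.norm.pow 2).const_mul c)
  rw [tendsto_zero_iff_norm_tendsto_zero]
  simpa using h1.sqrt

/-- A form-Cauchy sequence has norm-Cauchy preimages under `S`, and the limit of these is a preimage
of the required limit. -/
theorem isClosed (hq : q.IsTransport S G z) (h : IsCompactPair S G) : q.IsClosed := by
  intro x w hx hqx
  choose u hu using fun n => hq.mem_domain_iff.1 (x n).2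
  have hdiff : Tendsto (fun p : ℕ × ℕ => u p.1 - u p.2) atTop (𝓝 0) := by
    refine hq.tendsto_preimage h (fun p : ℕ × ℕ => x p.1 - x p.2)
      (fun p => by rw [map_sub, hu, hu]; rfl) ?_ hqx
    have h1 := (cauchySeq_iff_tendsto_dist_atTop_0.1 hx.cauchySeq)
    rw [tendsto_zero_iff_norm_tendsto_zero]
    simpa [dist_eq_norm] using h1
  have hcau : CauchySeq u := by
    rw [cauchySeq_iff_tendsto_dist_atTop_0]
    simpa [dist_eq_norm] using hdiff.norm
  obtain ⟨v, hv⟩ := cauchySeq_tendsto_of_complete hcau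
  have hSv : S v = w := by
    refine tendsto_nhds_unique ((S.continuous.tendsto v).comp hv) (hx.congr fun n => ?_)
    exact (hu n).symm
  refine ⟨hq.mem_domain_iff.2 ⟨v, hSv⟩, ?_⟩
  refine hq.tendsto_quad (u := fun n => u n - v) _ (fun n => ?_) ?_
  · rw [map_sub, hu, hSv]
    rfl
  · simpa using hv.sub_const v

theorem exists_real_of_tendsto (hq : q.IsTransport S G z) (h : IsCompactPair S G)
    (x : ℕ → q.domain) (hx : ∀ n, ‖(x n : H)‖ = 1) (hnull : WeaklyNull fun n => (x n : H)) {w : ℂ}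
    (hw : Tendsto (fun n => q.quad (x n)) atTop (𝓝 w)) : w ∈ ((↑) : ℝ → ℂ) '' Set.Ici 0 := by
  choose u hu using fun n => hq.mem_domain_iff.1 (x n).2
  obtain ⟨c, hc0, hc⟩ := hq.exists_norm_sq_le h
  obtain ⟨b, hb⟩ := hw.norm.bddAbove_range
  -- The form values are bounded by `b` and `‖x n‖ = 1`, so the form norm estimate bounds the
  -- preimages.
  have hbd : ∀ n, ‖u n‖ ≤ √(2 * b + c) := fun n => by
    refine Real.le_sqrt_of_sq_le ?_
    have h1 := hc (x n) (u n) (hu n)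
    have h2 := hb ⟨n, rfl⟩
    simp only [hx n] at h1 h2
    linarith
  have hun : WeaklyNull u := h.weaklyNull_of_map hbd (by simpa only [hu] using hnull)
  have hG := h.tendsto_right u _ hun hbd
  have hinner : Tendsto (fun n => z * inner ℂ (u n) (G (u n))) atTop (𝓝 0) := by
    have h1 : Tendsto (fun n => inner ℂ (u n) (G (u n))) atTop (𝓝 0) := by
      refine squeeze_zero_norm (fun n => ?_) (by simpa using hG.norm.const_mul (√(2 * b + c)))
      exact (norm_inner_le_norm _ _).trans (mul_le_mul_of_nonneg_right (hbd n) (norm_nonneg _))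
    simpa using h1.const_mul z
  have hreal : Tendsto (fun n => ((‖u n‖ ^ 2 - ‖S (u n)‖ ^ 2 : ℝ) : ℂ)) atTop (𝓝 w) := by
    have := hw.sub hinner
    rw [sub_zero] at this
    refine this.congr fun n => ?_
    rw [hq.quad_eq (x n) (hu n)]
    ring
  have hclosed : _root_.IsClosed (((↑) : ℝ → ℂ) '' Set.Ici 0) :=
    Complex.isometry_ofReal.isClosedEmbedding.isClosedMap _ isClosed_Ici
  refine hclosed.mem_of_tendsto hreal (Eventually.of_forall fun n => ⟨_, ?_, rfl⟩)
  have := h.norm_left_le (u n)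
  have := norm_nonneg (S (u n))
  simp only [Set.mem_Ici]
  nlinarith

theorem isSymm {t : ℝ} (hq : q.IsTransport S G t) (h : IsCompactPair S G) : q.IsSymm := by
  intro x y
  obtain ⟨u, hu⟩ := hq.mem_domain_iff.1 x.2
  obtain ⟨v, hv⟩ := hq.mem_domain_iff.1 y.2
  rw [hq.apply_eq x y u v hu hv, hq.apply_eq y x v u hv hu, map_add, map_sub, map_mul,
    inner_conj_symm, inner_conj_symm, inner_conj_symm, Complex.conj_ofReal,
    inner_map_comm_of_isSelfAdjoint h.isSelfAdjoint_right]

end SesqForm.IsTransport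

/-! ### The self-adjoint operator of a perturbed form -/

/-- The operator `Q⁻¹ - c` for an injective self-adjoint bounded operator `Q`. -/
theorem exists_isSelfAdjoint_inv_sub {Q : H →L[ℂ] H} (hQ : IsSelfAdjoint Q)
    (hinj : Function.Injective Q) (c : ℝ) :
    ∃ T : H →ₗ.[ℂ] H, IsSelfAdjoint T ∧
      ∀ x y, (x, y) ∈ T.graph ↔ Q (y + (c : ℂ) • x) = x := by
  let g : Submodule ℂ (H × H) := LinearMap.ker (Q.toLinearMap ∘ₗ
    (LinearMap.snd ℂ H H + (c : ℂ) • LinearMap.fst ℂ H H) - LinearMap.fst ℂ H H)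
  have hg : ∀ x y, (x, y) ∈ g ↔ Q (y + (c : ℂ) • x) = x := fun x y => by
    simp [g, sub_eq_zero]
  have hgraph : g.toLinearPMap.graph = g := by
    refine g.toLinearPMap_graph_eq ?_
    rintro ⟨x, y⟩ h hx
    simp only at hx
    subst hx
    rw [hg] at h
    exact hinj (by simpa using h)
  have hT : ∀ x y, (x, y) ∈ g.toLinearPMap.graph ↔ Q (y + (c : ℂ) • x) = x := fun x y => by
    rw [hgraph, hg]
  have hdense : Dense (g.toLinearPMap.domain : Set H) := by
    refine (denseRange_of_isSelfAdjoint_of_injective hQ hinj).mono ?_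
    rintro _ ⟨w, rfl⟩
    have : (Q w, w - (c : ℂ) • Q w) ∈ g.toLinearPMap.graph := by
      rw [hT]
      simp
    exact LinearPMap.mem_domain_of_mem_graph this
  refine ⟨g.toLinearPMap, ?_, hT⟩
  rw [LinearPMap.isSelfAdjoint_def]
  refine LinearPMap.eq_of_eq_graph ?_
  rw [LinearPMap.adjoint_graph_eq_graph_adjoint hdense]
  ext ⟨x, y⟩
  rw [hT, Submodule.mem_adjoint_iff]
  -- The pairs `(Q w, w - c Q w)` exhaust the graph. Testing the adjoint relation on them gives
  -- exactly `Q (y + c x) = x`.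
  have hw : ∀ w, inner ℂ (w - (c : ℂ) • Q w) x - inner ℂ (Q w) y
      = inner ℂ w (x - Q (y + (c : ℂ) • x)) := fun w => by
    simp only [inner_sub_left, inner_smul_left, Complex.conj_ofReal, inner_sub_right, map_add,
      map_smul, inner_add_right, inner_smul_right, inner_map_comm_of_isSelfAdjoint hQ]
    ring
  constructor
  · intro h
    refine (sub_eq_zero.1 (ext_inner_left ℂ fun w => ?_)).symm
    rw [← hw, inner_zero_right]
    exact h _ _ ((hT _ _).2 (by simp))
  · intro h a b hab
    rw [hT] at hab
    have h1 := hw (b + (c : ℂ) • a)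
    rw [hab, h, sub_self, inner_zero_right, add_sub_cancel_right] at h1
    exact h1

/-- The bounded operator `M` with `⟨M u, v⟩ = (𝔞 + t𝔟 + c)[S u, S v]`. -/
def shiftedForm (S G : H →L[ℂ] H) (t c : ℝ) : H →L[ℂ] H :=
  1 + ((c - 1 : ℝ) : ℂ) • (S * S) + (t : ℂ) • G

theorem shiftedForm_apply {H : Type*} [NormedAddCommGroup H] [InnerProductSpace ℂ H]
    (S G : H →L[ℂ] H) (t c : ℝ) (u : H) :
    shiftedForm S G t c u = u - S (S u) + (t : ℂ) • G u + (c : ℂ) • S (S u) := by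
  simp only [shiftedForm, add_apply, smul_apply, mul_apply_eq_comp, one_apply_eq_self]
  push_cast
  rw [sub_smul, one_smul]
  abel

theorem IsCompactPair.isSelfAdjoint_shiftedForm {S G : H →L[ℂ] H} (h : IsCompactPair S G)
    (t c : ℝ) : IsSelfAdjoint (shiftedForm S G t c) := by
  have h1 : IsSelfAdjoint (S * S) := by
    rw [IsSelfAdjoint, star_mul, h.isSelfAdjoint_left.star_eq]
  have hr : ∀ r : ℝ, IsSelfAdjoint (r : ℂ) := fun r => Complex.conj_ofReal r
  exact ((IsSelfAdjoint.one _).add ((hr _).smul h1)).add ((hr _).smul h.isSelfAdjoint_right)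

/-- With `c = 1 + M` the quadratic form is `‖u‖² + M ‖S u‖² + t ⟨u, G u⟩`. The choice of `M` makes
it at least `‖u‖² / 2`, so the operator is coercive and invertible. -/
theorem IsCompactPair.exists_inverse {S G : H →L[ℂ] H} (h : IsCompactPair S G) (t : ℝ) :
    ∃ (c : ℝ) (N : H →L[ℂ] H), IsSelfAdjoint N ∧ (∀ u, N (shiftedForm S G t c u) = u) ∧
      ∀ u, shiftedForm S G t c (N u) = u := by
  obtain ⟨M, hM, hb⟩ := h.exists_mul_bound t
  have hunit : IsUnit (shiftedForm S G t (1 + M)) := by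
    refine ContinuousLinearMap.isUnit_of_forall_le_norm_inner_map _
      (c := 1 / 2) (by norm_num) fun u => ?_
    have e : inner ℂ u (shiftedForm S G t (1 + M) u)
        = ((‖u‖ ^ 2 + M * ‖S u‖ ^ 2 : ℝ) : ℂ) + t * inner ℂ u (G u) := by
      rw [shiftedForm_apply]
      simp only [inner_add_right, inner_sub_right, inner_smul_right]
      rw [← inner_map_comm_of_isSelfAdjoint h.isSelfAdjoint_left, inner_self_eq_norm_sq_to_K,
        inner_self_eq_norm_sq_to_K]
      push_cast
      simp only [Complex.coe_algebraMap]
      ring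
    have e2 : inner ℂ (shiftedForm S G t (1 + M) u) u
        = inner ℂ u (shiftedForm S G t (1 + M) u) :=
      inner_map_comm_of_isSelfAdjoint (h.isSelfAdjoint_shiftedForm t (1 + M)) _ _
    rw [e2]
    have h1 := Complex.re_le_norm (inner ℂ u (shiftedForm S G t (1 + M) u))
    have h2 := (abs_le.1 (Complex.abs_re_le_norm ((t : ℂ) * inner ℂ u (G u)))).1
    rw [e, Complex.add_re, Complex.ofReal_re] at h1
    rw [e]
    refine le_trans ?_ h1
    have h3 := hb u
    push_cast
    linarith
  obtain ⟨V, hV⟩ := hunit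
  refine ⟨1 + M, ((V⁻¹ : (H →L[ℂ] H)ˣ) : H →L[ℂ] H), ?_, fun u => ?_, fun u => ?_⟩
  · have hsa : IsSelfAdjoint V := by
      refine Units.ext ?_
      rw [Units.coe_star, hV]
      exact h.isSelfAdjoint_shiftedForm t (1 + M)
    have h2 : star V⁻¹ = V⁻¹ := by
      rw [star_inv, hsa.star_eq]
    rw [IsSelfAdjoint, ← Units.coe_star, h2]
  · rw [← hV]
    exact congrArg (fun L : H →L[ℂ] H => L u) V.inv_mul
  · rw [← hV]
    exact congrArg (fun L : H →L[ℂ] H => L u) V.mul_inv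

namespace SesqForm.IsTransport

variable {q : SesqForm H} {S G N : H →L[ℂ] H} {t c : ℝ}

/-- For `x = S ξ`, the weak form of `T x + c x = w` is `shiftedForm S G t c ξ = S w`, so `(T + c)⁻¹`
has to be `S N S`. -/
theorem exists_isOperatorOf (hq : q.IsTransport S G t) (h : IsCompactPair S G) :
    ∃ T, IsOperatorOf T q := by
  obtain ⟨c, N, hN, hNM, hMN⟩ := h.exists_inverse t
  have hSsa := h.isSelfAdjoint_left
  have hNinj : Function.Injective N := Function.LeftInverse.injective hMN
  set Q := S * N * S with hQdef
  have hQ : IsSelfAdjoint Q := by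
    rw [IsSelfAdjoint, hQdef, star_mul, star_mul, hSsa.star_eq, hN.star_eq, mul_assoc]
  have hQinj : Function.Injective Q :=
    h.injective_left.comp (hNinj.comp h.injective_left)
  obtain ⟨T, hT, hgraph⟩ := exists_isSelfAdjoint_inv_sub hQ hQinj c
  have hmem : ∀ x : T.domain, S (N (S (T x + (c : ℂ) • (x : H)))) = x := fun x =>
    (hgraph _ _).1 (T.mem_graph x)
  refine ⟨T, hT, ⟨fun x hx => ?_, fun w => ?_⟩, fun x y hx hy => ?_⟩
  · exact hq.mem_domain_iff.2 ⟨_, hmem ⟨x, hx⟩⟩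
  · obtain ⟨ξ, hξ⟩ := hq.mem_domain_iff.1 w.2
    -- Core property: approximating `shiftedForm S G t c ξ` by vectors `S (y n)` gives `N (S (y n))
    -- → ξ`, and `S (N (S (y n)))` lies in the domain of `T`.
    obtain ⟨v, hv, hlim⟩ := mem_closure_iff_seq_limit.1
      (h.denseRange_left (shiftedForm S G t c ξ))
    choose y hy using hv
    have hlim' : Tendsto (fun n => N (S (y n))) atTop (𝓝 ξ) := by
      have := (N.continuous.tendsto _).comp hlim
      rw [hNM] at this
      refine this.congr fun n => ?_
      simp [hy]
    refine ⟨fun n => ⟨S (N (S (y n))), hq.mem_domain_iff.2 ⟨_, rfl⟩⟩, fun n => ?_, ?_, ?_⟩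
    · refine LinearPMap.mem_domain_of_mem_graph (y := y n - (c : ℂ) • S (N (S (y n)))) ?_
      rw [hgraph, sub_add_cancel]
      rfl
    · rw [← hξ]
      exact (S.continuous.tendsto ξ).comp hlim'
    · refine hq.tendsto_quad (u := fun n => N (S (y n)) - ξ) _ (fun n => ?_) ?_
      · rw [map_sub, hξ]
        rfl
      · simpa using hlim'.sub_const ξ
  · set ξ := N (S (T x + (c : ℂ) • (x : H))) with hξ
    have hx' : S ξ = x := hmem x
    obtain ⟨η, hη⟩ := hq.mem_domain_iff.1 hy
    rw [hq.apply_eq ⟨x, hx⟩ ⟨y, hy⟩ ξ η hx' hη]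
    have h1 : shiftedForm S G t c ξ = S (T x + (c : ℂ) • (x : H)) := hMN _
    rw [shiftedForm_apply, hx', map_add, map_smul, add_left_inj] at h1
    rw [← hη, inner_map_comm_of_isSelfAdjoint hSsa, ← h1, inner_map_comm_of_isSelfAdjoint hSsa,
      hx']
    simp only [inner_add_right, inner_sub_right, inner_smul_right]

/-- The graph of the operator of a form is determined by the form. -/
theorem mem_graph_iff (hq : q.IsTransport S G t) (h : IsCompactPair S G) (hN : IsSelfAdjoint N)
    (hNM : ∀ u, N (shiftedForm S G t c u) = u)
    {T : H →ₗ.[ℂ] H} (hT : IsOperatorOf T q) {x y : H} :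
    (x, y) ∈ T.graph ↔ S (N (S (y + (c : ℂ) • x))) = x := by
  obtain ⟨hTsa, ⟨hle, hcore⟩, hform⟩ := hT
  have hSsa := h.isSelfAdjoint_left
  have himp : ∀ {x y : H}, (x, y) ∈ T.graph → S (N (S (y + (c : ℂ) • x))) = x := by
    intro x y hxy
    obtain ⟨x', hx1, hx2⟩ := T.mem_graph_iff.1 hxy
    simp only at hx1 hx2
    obtain ⟨ξ, hξ⟩ := hq.mem_domain_iff.1 (hle x'.2)
    -- The identity `⟨T x, w⟩ = q[x, w]` is known only for `w` in the domain of `T`. Core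
    -- approximation makes the preimages converge in norm, which extends it to all `S η`.
    have key : S y = ξ - S (S ξ) + (t : ℂ) • G ξ := by
      refine ext_inner_left ℂ fun η => ?_
      obtain ⟨w, hw, hwlim, hwq⟩ := hcore ⟨S η, hq.mem_domain_iff.2 ⟨η, rfl⟩⟩
      choose ζ hζ using fun n => hq.mem_domain_iff.1 (w n).2
      have hζ0 : Tendsto (fun n => ζ n - η) atTop (𝓝 0) := by
        refine hq.tendsto_preimage h _ (fun n => ?_) ?_ hwq
        · rw [map_sub, hζ]
          rfl
        · simpa using hwlim.sub_const (S η)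
      have hζlim : Tendsto ζ atTop (𝓝 η) := by simpa using hζ0.add_const η
      have h1 : Tendsto (fun n => inner ℂ (ζ n) (S y)) atTop (𝓝 (inner ℂ η (S y))) :=
        hζlim.inner tendsto_const_nhds
      have h2 : Tendsto (fun n => inner ℂ (ζ n) (ξ - S (S ξ) + (t : ℂ) • G ξ)) atTop
          (𝓝 (inner ℂ η (ξ - S (S ξ) + (t : ℂ) • G ξ))) := hζlim.inner tendsto_const_nhds
      refine tendsto_nhds_unique h1 (h2.congr fun n => ?_)
      have h3 := hform x' ⟨w n, hw n⟩ (hle x'.2) (w n).2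
      rw [hq.apply_eq ⟨x', hle x'.2⟩ ⟨w n, (w n).2⟩ ξ (ζ n) hξ (hζ n), hx2] at h3
      simp only at h3
      rw [← hζ n, inner_map_comm_of_isSelfAdjoint hSsa,
        inner_map_comm_of_isSelfAdjoint hSsa] at h3
      rw [h3]
      simp only [inner_add_right, inner_sub_right, inner_smul_right]
    have hx : S ξ = x := hξ.trans hx1
    have h4 : S (y + (c : ℂ) • x) = shiftedForm S G t c ξ := by
      rw [map_add, map_smul, key, shiftedForm_apply, hx]
    rw [h4, hNM, hx]
  refine ⟨himp, fun hxy => ?_⟩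
  -- A self-adjoint operator has no proper symmetric extension; the given pair is symmetric to the
  -- whole graph because `S N S` is self-adjoint.
  rw [mem_graph_iff_of_isSelfAdjoint hTsa]
  intro a b hab
  have ha := himp hab
  set w := b + (c : ℂ) • a with hw
  set v := y + (c : ℂ) • x with hv
  have hb : b = w - (c : ℂ) • a := by rw [hw]; abel
  have hy : y = v - (c : ℂ) • x := by rw [hv]; abel
  rw [hb, hy, inner_sub_left, inner_sub_right, inner_smul_left, inner_smul_right,
    Complex.conj_ofReal]
  congr 1
  nth_rewrite 1 [← hxy]
  nth_rewrite 1 [← ha]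
  rw [inner_map_comm_of_isSelfAdjoint hSsa, inner_map_comm_of_isSelfAdjoint hN,
    inner_map_comm_of_isSelfAdjoint hSsa]

/-- Here `a n = A (x n)` for a Weyl sequence `x n` of `A`. The vectors `u n = c (T + c)⁻¹ (x n)`
satisfy `T (u n) = c (x n - u n)`, and `x n - u n = S N (S (a n) + t G (y n)) → 0` because the
preimages `y n` of `x n` are bounded and weakly null. -/
theorem zero_mem_essSpectrum (hq : q.IsTransport S G t) (h : IsCompactPair S G)
    {T : H →ₗ.[ℂ] H} (hT : IsOperatorOf T q) {x a : ℕ → H} (hx : ∀ n, ‖x n‖ = 1)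
    (hnull : WeaklyNull x) (ha : Tendsto a atTop (𝓝 0)) (hxa : ∀ n, S (S (a n + x n)) = x n) :
    (0 : ℂ) ∈ essSpectrum T := by
  obtain ⟨c, N, hN, hNM, -⟩ := h.exists_inverse t
  have hgraph : ∀ {x y}, (x, y) ∈ T.graph ↔ S (N (S (y + (c : ℂ) • x))) = x :=
    hq.mem_graph_iff h hN hNM hT
  set y : ℕ → H := fun n => S (a n + x n) with hy
  have hSy : ∀ n, S (y n) = x n := hxa
  obtain ⟨b, hb⟩ := ha.norm.bddAbove_range
  have hyb : ∀ n, ‖y n‖ ≤ b + 1 := fun n => by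
    refine (h.norm_left_le _).trans ((norm_add_le _ _).trans ?_)
    rw [hx]
    have := hb ⟨n, rfl⟩
    simp only at this
    linarith
  have hynull : WeaklyNull y := h.weaklyNull_of_map hyb (by simpa only [hSy] using hnull)
  have hGy := h.tendsto_right y _ hynull hyb
  set u : ℕ → H := fun n => S (N (S ((c : ℂ) • x n))) with hu
  have hdiff : ∀ n, x n - u n = S (N (S (a n) + (t : ℂ) • G (y n))) := fun n => by
    have h1 : S (a n) + (t : ℂ) • G (y n)
        = shiftedForm S G t c (y n) - S ((c : ℂ) • x n) := by
      rw [shiftedForm_apply, hSy, map_smul]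
      simp only [hy, map_add]
      abel
    rw [h1, map_sub, hNM, map_sub, hSy]
  have hd : Tendsto (fun n => x n - u n) atTop (𝓝 0) := by
    simp only [hdiff]
    have h1 : Tendsto (fun n => S (a n) + (t : ℂ) • G (y n)) atTop (𝓝 0) := by
      have h2 := ((S.continuous.tendsto 0).comp ha).add (hGy.const_smul (t : ℂ))
      simpa using h2
    have h3 := ((S * N).continuous.tendsto 0).comp h1
    rw [map_zero] at h3
    exact h3
  have hug : ∀ n, (u n, (c : ℂ) • (x n - u n)) ∈ T.graph := fun n => by
    rw [hgraph, ← smul_add, sub_add_cancel]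
  have hun : Tendsto (fun n => ‖u n‖) atTop (𝓝 1) := by
    have h1 : Tendsto (fun n => ‖u n‖ - ‖x n‖) atTop (𝓝 0) := by
      refine squeeze_zero_norm (fun n => ?_) (by simpa using hd.norm)
      rw [Real.norm_eq_abs, norm_sub_rev]
      exact abs_norm_sub_norm_le _ _
    simpa [hx] using h1.add_const 1
  -- The first few `u n` may vanish, so the sequence is shifted by `n₀` before normalizing.
  obtain ⟨n₀, hn₀⟩ :=
    (hun.eventually_const_lt (show (1 / 2 : ℝ) < 1 by norm_num)).exists_forall_of_atTop
  have hpos : ∀ n, 0 < ‖u (n + n₀)‖ := fun n => by linarith [hn₀ (n + n₀) (by omega)]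
  have hscale : Tendsto (fun n => ((‖u (n + n₀)‖⁻¹ : ℝ) : ℂ)) atTop (𝓝 1) := by
    have h1 := ((tendsto_add_atTop_iff_nat n₀).2 hun).inv₀ one_ne_zero
    rw [inv_one] at h1
    have h2 := (Complex.continuous_ofReal.tendsto 1).comp h1
    rw [Complex.ofReal_one] at h2
    exact h2
  have hdom : ∀ n, ((‖u (n + n₀)‖⁻¹ : ℝ) : ℂ) • u (n + n₀) ∈ T.domain := fun n =>
    T.domain.smul_mem _ (LinearPMap.mem_domain_of_mem_graph (hug _))
  have hval : ∀ n, T ⟨_, hdom n⟩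
      = ((‖u (n + n₀)‖⁻¹ : ℝ) : ℂ) • (c : ℂ) • (x (n + n₀) - u (n + n₀)) := fun n => by
    have h1 := T.graph.smul_mem ((‖u (n + n₀)‖⁻¹ : ℝ) : ℂ) (hug (n + n₀))
    obtain ⟨v, hv1, hv2⟩ := T.mem_graph_iff.1 h1
    simp only [Prod.smul_fst, Prod.smul_snd] at hv1 hv2
    rw [← hv2]
    congr 1
    exact Subtype.ext hv1.symm
  refine ⟨fun n => ⟨_, hdom n⟩, fun n => ?_, fun v => ?_, ?_⟩
  · rw [norm_smul, Complex.norm_real, Real.norm_eq_abs, abs_of_pos (inv_pos.2 (hpos n)),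
      inv_mul_cancel₀ (hpos n).ne']
  · have h1 : Tendsto (fun n => inner ℂ v (u n)) atTop (𝓝 0) := by
      have h2 := (hnull v).sub (tendsto_const_nhds.inner hd : Tendsto
        (fun n => inner ℂ v (x n - u n)) atTop (𝓝 (inner ℂ v 0)))
      simpa [inner_sub_right] using h2
    have h3 := hscale.mul ((tendsto_add_atTop_iff_nat n₀).2 h1)
    simpa only [inner_smul_right, mul_zero] using h3
  · have h1 := hscale.smul (((tendsto_add_atTop_iff_nat n₀).2 hd).const_smul (c : ℂ))
    have h2 := h1.norm
    simp only [smul_zero, norm_zero] at h2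
    refine h2.congr fun n => ?_
    rw [hval, zero_smul, sub_zero]

end SesqForm.IsTransport

/-! ### Form compact perturbations of a nonnegative operator -/

theorem norm_invSqrtShift_le {A : H →ₗ.[ℂ] H} (hA : IsSelfAdjoint A) (hpos : OpNonneg A)
    (u : H) : ‖invSqrtShift A u‖ ≤ ‖u‖ := by
  have h := congrArg (fun L : H →L[ℂ] H => inner ℂ u (L u)) (invSqrtShift_sq_add hA hpos)
  simp only [add_apply, mul_apply_eq_comp, inner_add_right, one_apply_eq_self] at h
  rw [← inner_map_comm_of_isSelfAdjoint (isSelfAdjoint_invSqrtShift A),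
    ← inner_map_comm_of_isSelfAdjoint (isSelfAdjoint_sqrtMulInvSqrtShift A),
    inner_self_eq_norm_sq_to_K, inner_self_eq_norm_sq_to_K, inner_self_eq_norm_sq_to_K] at h
  have h' : ‖invSqrtShift A u‖ ^ 2 + ‖sqrtMulInvSqrtShift A u‖ ^ 2 = ‖u‖ ^ 2 := by
    exact_mod_cast h
  exact (abs_le_of_sq_le_sq' (by nlinarith [sq_nonneg ‖sqrtMulInvSqrtShift A u‖])
    (norm_nonneg _)).2

theorem exists_isCompactPair_isTransport {A B : H →ₗ.[ℂ] H} (hA : IsSelfAdjoint A)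
    (hB : IsSelfAdjoint B) (hpos : OpNonneg A)
    (hdom : (sqrtAbs A).domain ≤ (sqrtAbs B).domain) (hcompact : IsRelFormCompact A B) :
    ∃ G : H →L[ℂ] H, IsCompactPair (invSqrtShift A) G ∧
      ∀ z, ((formOf A).addSmul z (formOf B)).IsTransport (invSqrtShift A) G z := by
  obtain ⟨G, hG, hGnull, hGform⟩ := exists_transported_form hA hB hpos hdom hcompact
  refine ⟨G, ⟨isSelfAdjoint_invSqrtShift A, invSqrtShift_injective hA hpos,
    norm_invSqrtShift_le hA hpos, hG, hGnull⟩, fun z => ⟨fun {x} => ?_, ?_⟩⟩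
  · rw [← mem_sqrtAbs_domain_iff hA hpos]
    exact ⟨fun hx => hx.1, fun hx => ⟨hx, hdom hx⟩⟩
  · rintro ⟨x, hx⟩ ⟨y, hy⟩ u v hu hv
    simp only at hu hv
    subst hu hv
    change (formOf A).toFun ⟨_, hx.1⟩ ⟨_, hy.1⟩ + z * (formOf B).toFun ⟨_, hx.2⟩ ⟨_, hy.2⟩ = _
    rw [formOf_invSqrtShift hA hpos, hGform]

theorem isTypeA_addSmul {A B : H →ₗ.[ℂ] H} (hA : IsSelfAdjoint A)
    (hdom : (sqrtAbs A).domain ≤ (sqrtAbs B).domain) {S G : H →L[ℂ] H} (h : IsCompactPair S G)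
    (hq : ∀ z, ((formOf A).addSmul z (formOf B)).IsTransport S G z) :
    IsTypeA fun z : ℂ => (formOf A).addSmul z (formOf B) := by
  refine ⟨fun z => ⟨(hq z).isSectorial h, (hq z).isClosed h⟩, (formOf A).domain,
    fun z => inf_eq_left.2 hdom, dense_funCalc_domain hA _, fun x y => ?_⟩
  change Differentiable ℂ fun z => (formOf A).toFun ⟨x, x.2⟩ ⟨y, y.2⟩
    + z * (formOf B).toFun ⟨x, hdom x.2⟩ ⟨y, hdom y.2⟩
  fun_prop

end EssNumRange

end

/-! ### The three assertions -/

theorem lemma4p5 {H : Type*} [NormedAddCommGroup H] [InnerProductSpace ℂ H] [CompleteSpace H]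
    (A B : H →ₗ.[ℂ] H) (hA : IsSelfAdjoint A) (hB : IsSelfAdjoint B)
    (hA_nonneg : EssNumRange.OpNonneg A)
    (hdom : (EssNumRange.sqrtAbs A).domain ≤ (EssNumRange.sqrtAbs B).domain)
    (hcompact : EssNumRange.IsRelFormCompact A B) :
    ((EssNumRange.formOf A).addSmul Complex.I (EssNumRange.formOf B)).essNumRange
      ⊆ ((↑) : ℝ → ℂ) '' Set.Ici 0 ∧
    (∃ T : ℝ → (H →ₗ.[ℂ] H), EssNumRange.IsTypeBFamily
      (fun z : ℂ => (EssNumRange.formOf A).addSmul z (EssNumRange.formOf B)) T) ∧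
    (∀ T : ℝ → (H →ₗ.[ℂ] H), EssNumRange.IsTypeBFamily
      (fun z : ℂ => (EssNumRange.formOf A).addSmul z (EssNumRange.formOf B)) T →
      (0 : ℂ) ∈ EssNumRange.essSpectrum A →
      ∀ t : ℝ, EssNumRange.IsRealMin (EssNumRange.essSpectrum (T t)) 0) := by
  obtain ⟨G, h, hq⟩ := EssNumRange.exists_isCompactPair_isTransport hA hB hA_nonneg hdom hcompact
  refine ⟨?_, ?_, ?_⟩
  · rintro w ⟨x, hx, hnull, hw⟩
    exact (hq Complex.I).exists_real_of_tendsto h x hx hnull hw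
  · choose T hT using fun t : ℝ => (hq t).exists_isOperatorOf h
    exact ⟨T, EssNumRange.isTypeA_addSmul hA hdom h hq, fun t => (hq t).isSymm h, hT⟩
  · rintro T ⟨-, -, hT⟩ ⟨x, hx, hnull, hlim⟩ t
    constructor
    · have ha : Filter.Tendsto (fun n => A (x n)) Filter.atTop (nhds 0) := by
        rw [tendsto_zero_iff_norm_tendsto_zero]
        simpa using hlim
      exact (hq t).zero_mem_essSpectrum h (hT t) hx hnull ha fun n =>
        EssNumRange.invSqrtShift_sq_apply_add hA hA_nonneg (A.mem_graph (x n))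
    -- A Weyl sequence at `w` has `⟨T y_n, y_n⟩ → w`, and these are form values of normalized weakly
    -- null vectors; so `w` lies in `[0, ∞)`.
    · rintro w ⟨y, hy, hynull, hylim⟩
      obtain ⟨-, ⟨hle, -⟩, hform⟩ := hT t
      refine (hq t).exists_real_of_tendsto h (fun n => ⟨y n, hle (y n).2⟩) hy hynull ?_
      have h1 : Filter.Tendsto (fun n => inner ℂ (y n : H) (T t (y n) - w • (y n : H)))
          Filter.atTop (nhds 0) := by
        refine squeeze_zero_norm (fun n => ?_) hylim
        have h2 := norm_inner_le_norm (𝕜 := ℂ) (y n : H) (T t (y n) - w • (y n : H))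
        rwa [hy n, one_mul] at h2
      have h2 := h1.add_const w
      rw [zero_add] at h2
      refine h2.congr fun n => ?_
      rw [inner_sub_right, inner_smul_right, inner_self_eq_norm_sq_to_K, hy n,
        hform (y n) (y n) (hle (y n).2) (hle (y n).2)]
      simp [EssNumRange.SesqForm.quad]
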